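/- **Setting.** Let $d,m,N$ be natural numbers, $T>0$, $\lambda\ge 0$, let $A\subset\mathbb{R}^m$ be nonempty and compact, $\mathcal I=\{0,1\}^N$ and $\bar p=(1,\dots,1)$. For $p\in\mathcal I$ let $\mathcal I_p$ be the set of $\tilde p\in\mathcal I$ such that $p^i=1\Rightarrow\tilde p^i=1$ for all $i$, and $p^l=0$, $\tilde p^l=1$ for some $l$. Assume: * $f:\mathbb{R}^d\times A\times\mathcal I\to\mathbb{R}^d$ is continuous, bounded, and Lipschitz continuous in $x$ uniformly in $(a,p)$; * $\ell:\mathbb{R}^d\times A\times\mathcal I\times[0,T]\to[0,\infty)$ is bounded, continuous, and uniformly continuous in $x$ uniformly in $(a,p,t)$; * $C:\mathbb{R}^d\times\mathcal I\times\mathcal I\to[0,\infty)$ is uniformly continuous in $x$, uniformly in $p\in\mathcal I$, $p'\in\mathcal I_p$, and for every $p\neq\bar p$ the function $x\mapsto\min_{p'\in\mathcal I_p}C(x,p,p')$ is bounded (for instance, $C$ is bounded). Define $V_p:\mathbb{R}^d\times[0,T]\to\mathbb{R}$ backwards from $V_{\bar p}\equiv 0$: for $p\ne\bar p$, $$V_p(x,t)=\inf_{\alpha,\tau,p'}\Big(\int_t^\tau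 e^{-\lambda(s-t)}\ell(y(s),\alpha(s),p,s)\,ds+e^{-\lambda(\tau-t)}\big(C(y(\tau),p,p')+V_{p'}(y(\tau),\tau)\big)\Big),$$ where the infimum is over measurable $\alpha:[0,\infty)\to A$, $\tau\in[t,T]$ and $p'\in\mathcal I_p$, and $y$ is the absolutely continuous solution of $y'(s)=f(y(s),\alpha(s),p)$ for a.e. $s\in(t,T]$, $y(t)=x$. Put $H^p(x,t,\xi)=\sup_{a\in A}\{-f(x,a,p)\cdot\xi-\ell(x,a,p,t)\}$. For a family $U=\{u_p:p\in\mathcal I\}$ of bounded and uniformly continuous functions (BUC) on $\mathbb{R}^d\times[0,T]$ and $p\neq\bar p$, put $\psi^U_p(x,t)=\inf_{p'\in\mathcal I_p}(C(x,p,p')+u_{p'}(x,t))$ and consider the obstacle problem $$(\ast)_p^U\qquad\begin{cases}\max\{u-\psi_p^U,\,-u_t+\lambda u+H^p(x,t,D_xu)\}=0 & \text{on }\mathbb{R}^d\times[0,T),\\ u(x,T)=\psi_p^U(x,T) & x\in\mathbb{R}^d,\end{cases}$$ in the viscosity sense: whenever $\varphi\in C^1(\mathbb{R}^d\times\mathbb{R})$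 and $u-\varphi$ has a local maximum (resp. minimum) relative to $\mathbb{R}^d\times[0,T)$ at $(x,t)\in\mathbb{R}^d\times[0,T)$, one has $\max\{u-\psi_p^U,\,-\varphi_t+\lambda u+H^p(x,t,D_x\varphi)\}\le 0$ (resp. $\ge 0$) at $(x,t)$; the terminal condition holds pointwise. **Theorem.** The family $V=\{V_p:p\in\mathcal I\}$ is the unique family $U=\{u_p:p\in\mathcal I\}$ of BUC functions on $\mathbb{R}^d\times[0,T]$ such that $u_{\bar p}=0$ and, for every $p\neq\bar p$, $u_p$ is the unique BUC viscosity solution of $(\ast)^U_p$. More precisely: 1. every $V_p$ is BUC, $V_{\bar p}=0$, and for every $p\ne\bar p$ the function $V_p$ is a viscosity solution of $(\ast)^V_p$; 2. for every $p\neq\bar p$, every BUC viscosity solution of $(\ast)^V_p$ equals $V_p$; 3. if $U$ is a family of BUC functions with $u_{\bar p}=0$ such that $u_p$ is a viscosity solution of $(\ast)^U_p$ for every $p\ne\bar p$, then $u_p=V_p$ on $\mathbb{R}^d\times[0,T]$ for every $p\in\mathcal I$. -/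

import Mathlib

open Set MeasureTheory

namespace OptVisit

/-- The continuous state space (and the ambient space of the controls): Euclidean space. -/
abbrev Eucl (n : ℕ) : Type := EuclideanSpace ℝ (Fin n)

/-- The discrete states `p = (p¹, …, pᴺ) ∈ {0,1}ᴺ` (`true` is `1`, `false` is `0`). -/
abbrev Switch (N : ℕ) : Type := Fin N → Bool

/-- The final discrete state `(1, …, 1)`. -/
def finalState (N : ℕ) : Switch N := fun _ => true

/-- The discrete states that can be reached from `p` by one switch. -/
def nextStates {N : ℕ} (p : Switch N) : Set (Switch N) :=
  {q | (∀ i, p i = true → q i = true) ∧ ∃ l, p l = false ∧ q l = true}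

/-- The number of zeros of a discrete state. -/
def zeros {N : ℕ} (p : Switch N) : ℕ := (Finset.univ.filter fun i => p i = false).card

theorem zeros_lt {N : ℕ} {p q : Switch N} (h : q ∈ nextStates p) : zeros q < zeros p := by
  obtain ⟨h1, l, hl0, hl1⟩ := h
  apply Finset.card_lt_card
  rw [Finset.ssubset_iff_of_subset]
  · exact ⟨l, by simp [hl0], by simp [hl1]⟩
  · intro i hi
    simp only [Finset.mem_filter, Finset.mem_univ, true_and] at hi ⊢
    by_contra hp
    have := h1 i (by simpa using hp)
    simp [this] at hi

/-- `y` is, on `[t, T]`, the (absolutely continuous) solution of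
`y'(s) = g (y(s), α(s))` for a.e. `s ∈ ]t, T]`, `y(t) = x`. -/
def IsTrajectory {d m : ℕ} {A : Set (Eucl m)} (T : ℝ) (g : Eucl d → A → Eucl d)
    (α : ℝ → A) (x : Eucl d) (t : ℝ) (y : ℝ → Eucl d) : Prop :=
  AbsolutelyContinuousOnInterval y t T ∧ y t = x ∧
    ∀ᵐ s : ℝ, s ∈ Ioc t T → HasDerivAt y (g (y s) (α s)) s

/-- The value functions `V_p` of the optimal stopping problems, defined backwards from the final
state: `V = 0` at the final state and otherwise
`V_p(x,t) = inf ∫_t^τ e^{-lam (s-t)} ℓ(y(s),α(s),p,s) ds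
  + e^{-lam (τ-t)} (C(y(τ),p,p') + V_{p'}(y(τ),τ))`,
the infimum being over the measurable controls `α`, the stopping times `τ ∈ [t,T]` and the
admissible destinations `p'`, where `y` is the trajectory of `f(·,·,p)` from `(x,t)` under `α`. -/
noncomputable def value {d m N : ℕ} {A : Set (Eucl m)} (T lam : ℝ)
    (f : Eucl d → A → Switch N → Eucl d) (ℓ : Eucl d → A → Switch N → ℝ → ℝ)
    (C : Eucl d → Switch N → Switch N → ℝ) (p : Switch N) (x : Eucl d) (t : ℝ) : ℝ :=
  if p = finalState N then 0
  else sInf {c : ℝ | ∃ α : ℝ → A, Measurable α ∧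
    ∃ y : ℝ → Eucl d, IsTrajectory T (fun z a => f z a p) α x t y ∧
    ∃ τ ∈ Icc t T, ∃ p' : nextStates p,
      c = (∫ s in t..τ, Real.exp (-lam * (s - t)) * ℓ (y s) (α s) p s)
        + Real.exp (-lam * (τ - t)) * (C (y τ) p p' + value T lam f ℓ C p' (y τ) τ)}
termination_by zeros p
decreasing_by exact zeros_lt p'.2

/-- `u` is bounded and uniformly continuous on `ℝᵈ × [0, T]`. -/
def IsBUC {d : ℕ} (T : ℝ) (u : Eucl d → ℝ → ℝ) : Prop :=
  (∃ K : ℝ, ∀ x, ∀ t ∈ Icc 0 T, |u x t| ≤ K) ∧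
    UniformContinuousOn (fun z : Eucl d × ℝ => u z.1 z.2) (univ ×ˢ Icc 0 T)

/-- The Hamiltonian `H(x,t,ξ) = sup_{a ∈ A} (-g(x,a)·ξ - k(x,a,t))`. -/
noncomputable def hamiltonian {d m : ℕ} {A : Set (Eucl m)} (g : Eucl d → A → Eucl d)
    (k : Eucl d → A → ℝ → ℝ) (x : Eucl d) (t : ℝ) (ξ : Eucl d) : ℝ :=
  ⨆ a : A, (-(inner ℝ (g x a) ξ) - k x a t)

/-- The left-hand side of the obstacle problem: `max (r - ψ(x,t)) (-q + lam r + H(x,t,ξ))`, where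
`r`, `q`, `ξ` are the value, the time derivative and the spatial gradient. -/
noncomputable def obstacleOp {d m : ℕ} {A : Set (Eucl m)} (lam : ℝ) (g : Eucl d → A → Eucl d)
    (k : Eucl d → A → ℝ → ℝ) (ψ : Eucl d → ℝ → ℝ) (x : Eucl d) (t r q : ℝ) (ξ : Eucl d) : ℝ :=
  max (r - ψ x t) (-q + lam * r + hamiltonian g k x t ξ)

/-- `u` is a viscosity solution of
`max (u - ψ, -u_t + lam u + H(x,t,D_x u)) = 0` on `ℝᵈ × [0,T[`, `u(·,T) = ψ(·,T)`. -/
def IsViscositySolution {d m : ℕ} {A : Set (Eucl m)} (T lam : ℝ) (g : Eucl d → A → Eucl d)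
    (k : Eucl d → A → ℝ → ℝ) (ψ : Eucl d → ℝ → ℝ) (u : Eucl d → ℝ → ℝ) : Prop :=
  (∀ φ : Eucl d × ℝ → ℝ, ContDiff ℝ 1 φ → ∀ x : Eucl d, ∀ t ∈ Ico 0 T,
    IsLocalMaxOn (fun z : Eucl d × ℝ => u z.1 z.2 - φ z) (univ ×ˢ Ico 0 T) (x, t) →
      obstacleOp lam g k ψ x t (u x t) (deriv (fun s => φ (x, s)) t)
        (gradient (fun z => φ (z, t)) x) ≤ 0) ∧
  (∀ φ : Eucl d × ℝ → ℝ, ContDiff ℝ 1 φ → ∀ x : Eucl d, ∀ t ∈ Ico 0 T,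
    IsLocalMinOn (fun z : Eucl d × ℝ => u z.1 z.2 - φ z) (univ ×ˢ Ico 0 T) (x, t) →
      0 ≤ obstacleOp lam g k ψ x t (u x t) (deriv (fun s => φ (x, s)) t)
        (gradient (fun z => φ (z, t)) x)) ∧
  ∀ x : Eucl d, u x T = ψ x T

/-- The obstacle `ψ_p^U(x,t) = inf_{p'} (C(x,p,p') + u_{p'}(x,t))` built from the family `U`, the
infimum being over the states reachable from `p` by one switch (a finite set, nonempty unless `p`
is the final state). -/
noncomputable def obstacle {d N : ℕ} (C : Eucl d → Switch N → Switch N → ℝ)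
    (U : Switch N → Eucl d → ℝ → ℝ) (p : Switch N) (x : Eucl d) (t : ℝ) : ℝ :=
  ⨅ p' : nextStates p, (C x p p' + U p' x t)

/-- The family `U` consists of BUC functions, vanishes at the final state, and each other member is
a viscosity solution of the obstacle problem whose obstacle is built from `U`. -/
def SolvesSystem {d m N : ℕ} {A : Set (Eucl m)} (T lam : ℝ)
    (f : Eucl d → A → Switch N → Eucl d) (ℓ : Eucl d → A → Switch N → ℝ → ℝ)
    (C : Eucl d → Switch N → Switch N → ℝ) (U : Switch N → Eucl d → ℝ → ℝ) : Prop :=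
  (∀ p, IsBUC T (U p)) ∧
  (∀ x, ∀ t ∈ Icc 0 T, U (finalState N) x t = 0) ∧
  ∀ p, p ≠ finalState N →
    IsViscositySolution T lam (fun x a => f x a p) (fun x a t => ℓ x a p t) (obstacle C U p) (U p)

/-- Each member of `U`, except at the final state, is the only BUC viscosity solution of the
obstacle problem whose obstacle is built from `U`. -/
def MembersUnique {d m N : ℕ} {A : Set (Eucl m)} (T lam : ℝ)
    (f : Eucl d → A → Switch N → Eucl d) (ℓ : Eucl d → A → Switch N → ℝ → ℝ)
    (C : Eucl d → Switch N → Switch N → ℝ) (U : Switch N → Eucl d → ℝ → ℝ) : Prop :=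
  ∀ p, p ≠ finalState N → ∀ w : Eucl d → ℝ → ℝ, IsBUC T w →
    IsViscositySolution T lam (fun x a => f x a p) (fun x a t => ℓ x a p t) (obstacle C U p) w →
    ∀ x, ∀ t ∈ Icc 0 T, w x t = U p x t

end OptVisit

open OptVisit

/-! The system is triangular. A switch strictly lowers the number of zeros (`zeros_lt`), so the
obstacle at `p` involves only states with fewer zeros. Strong induction on `zeros` reduces
everything to one stopping problem whose stopping cost `ψ` is a known BUC function.

For that problem three facts suffice. The value is BUC (`isBUC_stoppingValue`): trajectories depend
on their starting point in a Lipschitz way, and speed and running cost are bounded. It is a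
viscosity solution (`isViscositySolution_stoppingValue`): the dynamic programming inequalities
`stoppingValue_le_restart` and `restart_le_payoff` are combined with the first-order expansion
`eventually_expansion`, which is uniform in the controls. Finally, BUC solutions with the same `ψ`
are ordered (`IsViscositySolution.le`), by doubling the variables; applied both ways this is
uniqueness.

`value_eq_stoppingValue` links this to `value`: only finitely many `p'` are available, so minimising
over `p'` inside the infimum gives the obstacle as stopping cost. Uniqueness of the family follows
by the same induction: once two families agree on all states with fewer zeros, their obstacles at
`p` coincide.

Test functions may touch at `t = 0`, where extrema are one-sided. This is harmless, since dynamic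
programming only looks forward in time, and it spares the comparison proof any penalty at `t = 0`.
-/

namespace OptVisit

open Topology Filter

/-! ### Trajectories: existence, dependence on the starting point, concatenation. -/

section Trajectories

variable {d m : ℕ} {A : Set (Eucl m)} {g : Eucl d → A → Eucl d} {α : ℝ → A} {M L : ℝ}

theorem intervalIntegrable_field (hg : Continuous fun z : Eucl d × A => g z.1 z.2)
    (hM : ∀ x a, ‖g x a‖ ≤ M) (hα : Measurable α) {y : ℝ → Eucl d} {a b : ℝ}
    (hy : ContinuousOn y (uIcc a b)) :
    IntervalIntegrable (fun s => g (y s) (α s)) volume a b := by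
  have h1 : AEMeasurable y (volume.restrict (uIoc a b)) :=
    (hy.mono uIoc_subset_uIcc).aemeasurable measurableSet_uIoc
  have h2 : AEMeasurable (fun s => g (y s) (α s)) (volume.restrict (uIoc a b)) :=
    hg.measurable.comp_aemeasurable (h1.prodMk hα.aemeasurable)
  refine (intervalIntegrable_const (c := M)).mono_fun' h2.aestronglyMeasurable ?_
  exact Eventually.of_forall fun s => hM _ _

/-- With the weight `exp (2L(r - t))`, integrating a Lipschitz bound costs only the factor 1/2. This
serves both the contraction argument and the Grönwall-type estimate below. -/
theorem integral_exp_bound {L m t s : ℝ} (hm : 0 ≤ m) :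
    ∫ r in t..s, L * (m * Real.exp (2 * L * (r - t))) ≤ m / 2 * Real.exp (2 * L * (s - t)) := by
  have hd : ∀ r ∈ uIcc t s, HasDerivAt (fun r => m / 2 * Real.exp (2 * L * (r - t)))
      (L * (m * Real.exp (2 * L * (r - t)))) r := by
    intro r _
    have := (((((hasDerivAt_id r).sub_const t).const_mul (2 * L)).exp).const_mul (m / 2))
    refine this.congr_deriv ?_
    simp only [id]
    ring
  rw [intervalIntegral.integral_eq_sub_of_hasDerivAt hd
    ((by fun_prop : Continuous _).intervalIntegrable _ _)]
  simp
  linarith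

/-- `y` is continuous on `[t, T]` and solves there the integral equation of the trajectories. -/
def IsMild (T : ℝ) (g : Eucl d → A → Eucl d) (α : ℝ → A) (x : Eucl d) (t : ℝ)
    (y : ℝ → Eucl d) : Prop :=
  ContinuousOn y (Icc t T) ∧ ∀ s ∈ Icc t T, y s = x + ∫ r in t..s, g (y r) (α r)

theorem IsMild.intervalIntegrable (hg : Continuous fun z : Eucl d × A => g z.1 z.2)
    (hM : ∀ x a, ‖g x a‖ ≤ M) (hα : Measurable α) {y : ℝ → Eucl d} {x : Eucl d} {t T a b : ℝ}
    (hy : IsMild T g α x t y) (ha : a ∈ Icc t T) (hb : b ∈ Icc t T) :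
    IntervalIntegrable (fun s => g (y s) (α s)) volume a b :=
  intervalIntegrable_field hg hM hα (hy.1.mono (uIcc_subset_Icc ha hb))

theorem IsMild.sub_eq (hg : Continuous fun z : Eucl d × A => g z.1 z.2)
    (hM : ∀ x a, ‖g x a‖ ≤ M) (hα : Measurable α) {y : ℝ → Eucl d} {x : Eucl d} {t T a b : ℝ}
    (hy : IsMild T g α x t y) (ha : a ∈ Icc t T) (hb : b ∈ Icc t T) :
    y b - y a = ∫ r in a..b, g (y r) (α r) := by
  have ht : t ∈ Icc t T := ⟨le_rfl, ha.1.trans ha.2⟩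
  rw [hy.2 a ha, hy.2 b hb, add_sub_add_left_eq_sub,
    intervalIntegral.integral_interval_sub_left (hy.intervalIntegrable hg hM hα ht hb)
      (hy.intervalIntegrable hg hM hα ht ha)]

theorem IsMild.norm_sub_le (hg : Continuous fun z : Eucl d × A => g z.1 z.2)
    (hM : ∀ x a, ‖g x a‖ ≤ M) (hα : Measurable α) {y : ℝ → Eucl d} {x : Eucl d} {t T a b : ℝ}
    (hy : IsMild T g α x t y) (ha : a ∈ Icc t T) (hb : b ∈ Icc t T) :
    ‖y b - y a‖ ≤ M * |b - a| := by
  rw [hy.sub_eq hg hM hα ha hb]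
  exact intervalIntegral.norm_integral_le_of_norm_le_const fun r _ => hM _ _

theorem IsMild.apply_left {y : ℝ → Eucl d} {x : Eucl d} {t T : ℝ} (hy : IsMild T g α x t y)
    (htT : t ≤ T) : y t = x := by
  simpa using hy.2 t ⟨le_rfl, htT⟩

/-- Subtracting the integral of the field from an absolutely continuous solution leaves an
absolutely continuous function with derivative zero a.e., hence a constant. Conversely, the integral
of a bounded field is Lipschitz, and Lebesgue differentiation recovers the equation. -/
theorem isTrajectory_iff_isMild (hg : Continuous fun z : Eucl d × A => g z.1 z.2)
    (hM : ∀ x a, ‖g x a‖ ≤ M) (hα : Measurable α) {y : ℝ → Eucl d} {x : Eucl d} {t T : ℝ}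
    (htT : t ≤ T) : IsTrajectory T g α x t y ↔ IsMild T g α x t y := by
  have htm : t ∈ Icc t T := ⟨le_rfl, htT⟩
  have hTm : T ∈ Icc t T := ⟨htT, le_rfl⟩
  have hlip : ∀ z : ℝ → Eucl d, (∀ a ∈ Icc t T, ∀ b ∈ Icc t T, ‖z b - z a‖ ≤ M * |b - a|) →
      AbsolutelyContinuousOnInterval z t T := by
    intro z hz
    apply LipschitzOnWith.absolutelyContinuousOnInterval (K := M.toNNReal)
    rw [uIcc_of_le htT]
    refine LipschitzOnWith.of_dist_le_mul fun b hb a ha => ?_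
    rw [dist_eq_norm, Real.dist_eq]
    refine (hz a ha b hb).trans ?_
    gcongr
    exact Real.le_coe_toNNReal M
  constructor
  · rintro ⟨hac, hyt, hd⟩
    have hc : ContinuousOn y (Icc t T) := by
      have := hac.continuousOn
      rwa [uIcc_of_le htT] at this
    refine ⟨hc, ?_⟩
    have hint : ∀ {a b}, a ∈ Icc t T → b ∈ Icc t T →
        IntervalIntegrable (fun s => g (y s) (α s)) volume a b := fun ha hb =>
      intervalIntegrable_field hg hM hα (hc.mono (uIcc_subset_Icc ha hb))
    have hac2 : AbsolutelyContinuousOnInterval (fun s => ∫ r in t..s, g (y r) (α r)) t T := by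
      apply hlip
      intro a ha b hb
      rw [intervalIntegral.integral_interval_sub_left (hint htm hb) (hint htm ha)]
      exact intervalIntegral.norm_integral_le_of_norm_le_const fun r _ => hM _ _
    obtain ⟨c, hc⟩ := (hac.sub hac2).const_of_ae_hasDerivAt_zero (by
      have hne : ∀ᵐ s : ℝ, s ≠ t := by simp [ae_iff, measure_singleton]
      filter_upwards [hd, (hint htm hTm).ae_hasDerivAt_integral, hne] with s h1 h2 h3 hs
      have hs' := hs
      rw [uIcc_of_le htT] at hs'
      have := (h1 ⟨lt_of_le_of_ne hs'.1 (Ne.symm h3), hs'.2⟩).sub (h2 hs t (by simp))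
      rwa [sub_self] at this)
    rw [uIcc_of_le htT] at hc
    intro s hs
    have e1 := hc t htm
    have e2 := hc s hs
    simp only [Pi.sub_apply, intervalIntegral.integral_same, sub_zero] at e1 e2
    rw [← e1, hyt] at e2
    rw [← e2]
    abel
  · intro hy
    refine ⟨hlip y fun a ha b hb => hy.norm_sub_le hg hM hα ha hb, hy.apply_left htT, ?_⟩
    have hneT : ∀ᵐ s : ℝ, s ≠ T := by simp [ae_iff, measure_singleton]
    filter_upwards [(hy.intervalIntegrable hg hM hα htm hTm).ae_hasDerivAt_integral, hneT]
      with s h2 h3 hs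
    have h := (h2 (by rw [uIcc_of_le htT]; exact ⟨hs.1.le, hs.2⟩) t (by simp)).const_add x
    refine h.congr_of_eventuallyEq ?_
    filter_upwards [Icc_mem_nhds hs.1 (lt_of_le_of_ne hs.2 h3)] with r hr
    exact hy.2 r hr

/-- Picard iteration in a weighted sup norm, which makes the map a contraction on all of `[t, T]` at
once. -/
theorem exists_isMild (hg : Continuous fun z : Eucl d × A => g z.1 z.2)
    (hM : ∀ x a, ‖g x a‖ ≤ M) (hL0 : 0 < L) (hL : ∀ x y a, ‖g x a - g y a‖ ≤ L * ‖x - y‖)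
    (hα : Measurable α) (x : Eucl d) {t T : ℝ} (htT : t ≤ T) :
    ∃ y, IsMild T g α x t y := by
  have hY : ∀ z : C(Icc t T, Eucl d),
      Continuous fun r : ℝ => Real.exp (2 * L * (r - t)) • z (projIcc t T htT r) := by
    intro z
    have := z.continuous.comp (continuous_projIcc (h := htT))
    exact (by fun_prop : Continuous fun r : ℝ => Real.exp (2 * L * (r - t))).smul this
  have hint : ∀ (z : C(Icc t T, Eucl d)) (a b : ℝ), IntervalIntegrable (fun r =>
      g (Real.exp (2 * L * (r - t)) • z (projIcc t T htT r)) (α r)) volume a b := fun z a b =>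
    intervalIntegrable_field hg hM hα (hY z).continuousOn
  -- The unknown `z` is the rescaled path `exp (-2L(s - t)) • y s`, so that the ordinary sup
  -- distance of `z` is the weighted distance of `y`.
  let F : C(Icc t T, Eucl d) → C(Icc t T, Eucl d) := fun z =>
    ⟨fun s => Real.exp (-(2 * L * ((s : ℝ) - t))) • (x + ∫ r in t..s,
      g (Real.exp (2 * L * (r - t)) • z (projIcc t T htT r)) (α r)), by
      have h1 := (intervalIntegral.continuous_primitive (hint z) t).comp
        (continuous_subtype_val (p := fun s => s ∈ Icc t T))
      exact (by fun_prop : Continuous fun s : Icc t T => Real.exp (-(2 * L * ((s : ℝ) - t)))).smul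
        (continuous_const.add h1)⟩
  have hF : ContractingWith (1 / 2) F := by
    refine ⟨by norm_num, LipschitzWith.of_dist_le_mul fun z w => ?_⟩
    rw [ContinuousMap.dist_le (by positivity)]
    intro s
    have hts : t ≤ s := s.2.1
    simp only [F, ContinuousMap.coe_mk]
    rw [dist_smul₀, dist_add_left, dist_eq_norm, ← intervalIntegral.integral_sub (hint z _ _)
      (hint w _ _), Real.norm_of_nonneg (Real.exp_nonneg _)]
    have h1 : ‖∫ r in t..s, (g (Real.exp (2 * L * (r - t)) • z (projIcc t T htT r)) (α r) -
        g (Real.exp (2 * L * (r - t)) • w (projIcc t T htT r)) (α r))‖ ≤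
        ∫ r in t..s, L * (dist z w * Real.exp (2 * L * (r - t))) := by
      refine intervalIntegral.norm_integral_le_of_norm_le hts ?_
        ((by fun_prop : Continuous _).intervalIntegrable _ _)
      refine Eventually.of_forall fun r _ => (hL _ _ _).trans ?_
      rw [← smul_sub, norm_smul, Real.norm_of_nonneg (Real.exp_nonneg _), mul_comm (dist z w),
        ← dist_eq_norm]
      gcongr
      exact ContinuousMap.dist_apply_le_dist _
    have h2 := h1.trans (integral_exp_bound dist_nonneg)
    calc _ ≤ Real.exp (-(2 * L * ((s : ℝ) - t))) *
          (dist z w / 2 * Real.exp (2 * L * ((s : ℝ) - t))) := by gcongr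
      _ = dist z w / 2 := by
        rw [Real.exp_neg]
        field_simp
      _ = _ := by simp; ring
  let z := hF.fixedPoint F
  have hz : F z = z := hF.fixedPoint_isFixedPt
  refine ⟨fun r => Real.exp (2 * L * (r - t)) • z (projIcc t T htT r), (hY z).continuousOn, ?_⟩
  intro s hs
  have := congrArg (fun w : C(Icc t T, Eucl d) => w ⟨s, hs⟩) hz
  simp only [projIcc_of_mem htT hs]
  rw [← this]
  simp only [F, ContinuousMap.coe_mk, smul_smul, ← Real.exp_add, add_neg_cancel, Real.exp_zero,
    one_smul]

/-- Let `w` be the maximum of the weighted distance of the two paths. The integral equation at a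
maximum point gives `w ≤ ‖x - x'‖ + w / 2`. -/
theorem IsMild.norm_sub_le_initial (hg : Continuous fun z : Eucl d × A => g z.1 z.2)
    (hM : ∀ x a, ‖g x a‖ ≤ M) (hL0 : 0 < L) (hL : ∀ x y a, ‖g x a - g y a‖ ≤ L * ‖x - y‖)
    (hα : Measurable α) {x x' : Eucl d} {t T : ℝ} {y y' : ℝ → Eucl d}
    (hy : IsMild T g α x t y) (hy' : IsMild T g α x' t y') {s : ℝ} (hs : s ∈ Icc t T) :
    ‖y s - y' s‖ ≤ 2 * Real.exp (2 * L * (T - t)) * ‖x - x'‖ := by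
  have htm : t ∈ Icc t T := ⟨le_rfl, hs.1.trans hs.2⟩
  have hc : ContinuousOn (fun s => Real.exp (-(2 * L * (s - t))) * ‖y s - y' s‖) (Icc t T) :=
    (by fun_prop : Continuous fun s => Real.exp (-(2 * L * (s - t)))).continuousOn.mul
      (hy.1.sub hy'.1).norm
  obtain ⟨s₀, hs₀, hmax⟩ := isCompact_Icc.exists_isMaxOn ⟨t, htm⟩ hc
  set w := Real.exp (-(2 * L * (s₀ - t))) * ‖y s₀ - y' s₀‖ with hw
  have hw0 : 0 ≤ w := by positivity
  have hle : ∀ r ∈ Icc t T, ‖y r - y' r‖ ≤ w * Real.exp (2 * L * (r - t)) := by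
    intro r hr
    have := hmax hr
    simp only [mem_ofPred_eq] at this
    calc ‖y r - y' r‖ = Real.exp (-(2 * L * (r - t))) * ‖y r - y' r‖ * Real.exp (2 * L * (r - t)) := by
          rw [Real.exp_neg]; field_simp
      _ ≤ _ := by gcongr
  have h0 : ‖y s₀ - y' s₀‖ ≤ ‖x - x'‖ + w / 2 * Real.exp (2 * L * (s₀ - t)) := by
    rw [hy.2 s₀ hs₀, hy'.2 s₀ hs₀, add_sub_add_comm, ← intervalIntegral.integral_sub
      (hy.intervalIntegrable hg hM hα htm hs₀) (hy'.intervalIntegrable hg hM hα htm hs₀)]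
    refine (norm_add_le _ _).trans (add_le_add_right ?_ _)
    refine le_trans ?_ (integral_exp_bound hw0)
    refine intervalIntegral.norm_integral_le_of_norm_le hs₀.1 ?_
      ((by fun_prop : Continuous _).intervalIntegrable _ _)
    refine Eventually.of_forall fun r hr => (hL _ _ _).trans ?_
    gcongr
    exact hle r ⟨hr.1.le, hr.2.trans hs₀.2⟩
  have hw2 : w ≤ 2 * ‖x - x'‖ := by
    have h1 : w ≤ Real.exp (-(2 * L * (s₀ - t))) * ‖x - x'‖ + w / 2 := by
      calc w ≤ Real.exp (-(2 * L * (s₀ - t))) *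
            (‖x - x'‖ + w / 2 * Real.exp (2 * L * (s₀ - t))) := by
              rw [hw]; exact mul_le_mul_of_nonneg_left h0 (Real.exp_nonneg _)
        _ = _ := by
          rw [Real.exp_neg]; field_simp
    have h2 : Real.exp (-(2 * L * (s₀ - t))) ≤ 1 := by
      rw [Real.exp_le_one_iff]
      have := hs₀.1
      nlinarith
    have h3 := mul_le_mul_of_nonneg_right h2 (norm_nonneg (x - x'))
    linarith
  calc ‖y s - y' s‖ ≤ w * Real.exp (2 * L * (s - t)) := hle s hs
    _ ≤ 2 * ‖x - x'‖ * Real.exp (2 * L * (T - t)) := by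
      have := hs.2
      gcongr
    _ = _ := by ring

theorem IsMild.restart (hg : Continuous fun z : Eucl d × A => g z.1 z.2)
    (hM : ∀ x a, ‖g x a‖ ≤ M) (hα : Measurable α) {x : Eucl d} {t t' T : ℝ} {y : ℝ → Eucl d}
    (hy : IsMild T g α x t y) (ht' : t' ∈ Icc t T) : IsMild T g α (y t') t' y := by
  refine ⟨hy.1.mono (Icc_subset_Icc_left ht'.1), fun s hs => ?_⟩
  rw [← hy.sub_eq hg hM hα ht' ⟨ht'.1.trans hs.1, hs.2⟩]
  abel

theorem IsMild.concat (hg : Continuous fun z : Eucl d × A => g z.1 z.2)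
    (hM : ∀ x a, ‖g x a‖ ≤ M) {β : ℝ → A} (hα : Measurable α) (hβ : Measurable β)
    {x : Eucl d} {t t' T : ℝ} {y y' : ℝ → Eucl d}
    (hy : IsMild T g α x t y) (ht' : t' ∈ Icc t T) (hy' : IsMild T g β (y t') t' y') :
    IsMild T g (fun s => if s ≤ t' then α s else β s) x t
      (fun s => if s ≤ t' then y s else y' s) := by
  have hyt : y' t' = y t' := hy'.apply_left ht'.2
  have hc : ContinuousOn (fun s => if s ≤ t' then y s else y' s) (Icc t T) := by
    apply ContinuousOn.if
    · intro s hs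
      have : s = t' := by
        have := frontier_le_subset_eq continuous_id continuous_const hs.2
        simpa using this
      rw [this, hyt]
    · have : closure {a : ℝ | a ≤ t'} = Iic t' := isClosed_Iic.closure_eq
      rw [this]
      exact hy.1.mono inter_subset_left
    · refine hy'.1.mono fun s hs => ⟨?_, hs.1.2⟩
      have : closure {a : ℝ | ¬ a ≤ t'} ⊆ Ici t' :=
        closure_minimal (fun a ha => (not_le.1 ha).le) isClosed_Ici
      exact this hs.2
  have hγ : Measurable fun s => if s ≤ t' then α s else β s :=
    Measurable.ite measurableSet_Iic hα hβ
  refine ⟨hc, fun s hs => ?_⟩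
  have htm : t ∈ Icc t T := ⟨le_rfl, hs.1.trans hs.2⟩
  have hl : ∀ b ≤ t', t ≤ b → ∫ r in t..b, g (if r ≤ t' then y r else y' r)
      (if r ≤ t' then α r else β r) = ∫ r in t..b, g (y r) (α r) := by
    intro b hb htb
    refine intervalIntegral.integral_congr fun r hr => ?_
    rw [uIcc_of_le htb] at hr
    simp [hr.2.trans hb]
  rcases le_or_gt s t' with h | h
  · simp only [if_pos h]
    rw [hl s h hs.1]
    exact hy.2 s hs
  · simp only [if_neg (not_le.2 h)]
    have hi : ∀ {a b}, a ∈ Icc t T → b ∈ Icc t T → IntervalIntegrable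
        (fun r => g (if r ≤ t' then y r else y' r) (if r ≤ t' then α r else β r)) volume a b :=
      fun ha hb => intervalIntegrable_field hg hM hγ (hc.mono (uIcc_subset_Icc ha hb))
    rw [← intervalIntegral.integral_add_adjacent_intervals (hi htm ht') (hi ht' hs),
      hl t' le_rfl ht'.1, ← add_assoc, ← hy.2 t' ht', hy'.2 s ⟨h.le, hs.2⟩]
    congr 1
    refine intervalIntegral.integral_congr_ae (Eventually.of_forall fun r hr => ?_)
    rw [uIoc_of_le h.le] at hr
    simp [not_le.2 hr.1]

end Trajectories

/-! ### The one-state control problem and moduli of continuity. -/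

/-- The standing assumptions on the dynamics `g` and the running cost `k`. -/
structure IsControlProblem {d m : ℕ} {A : Set (Eucl m)} (T M L K : ℝ)
    (g : Eucl d → A → Eucl d) (k : Eucl d → A → ℝ → ℝ) : Prop where
  cont : Continuous fun z : Eucl d × A => g z.1 z.2
  norm_le : ∀ x a, ‖g x a‖ ≤ M
  lip_pos : 0 < L
  lip : ∀ x y a, ‖g x a - g y a‖ ≤ L * ‖x - y‖
  cost_cont : ContinuousOn (fun z : (Eucl d × A) × ℝ => k z.1.1 z.1.2 z.2) (univ ×ˢ Icc 0 T)
  cost_le : ∀ x a, ∀ t ∈ Icc 0 T, |k x a t| ≤ K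
  cost_unif : ∀ ε > 0, ∃ δ > 0, ∀ x y : Eucl d, ‖x - y‖ < δ → ∀ a, ∀ t ∈ Icc 0 T,
      |k x a t - k y a t| < ε

theorem IsBUC.exists_modulus {d : ℕ} {T : ℝ} {u : Eucl d → ℝ → ℝ} (hu : IsBUC T u) {ε : ℝ}
    (hε : 0 < ε) : ∃ δ > 0, ∀ x y : Eucl d, ∀ t ∈ Icc 0 T, ∀ s ∈ Icc 0 T, ‖x - y‖ < δ →
      |t - s| < δ → |u x t - u y s| < ε := by
  obtain ⟨δ, hδ, h⟩ := Metric.uniformContinuousOn_iff.1 hu.2 ε hε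
  refine ⟨δ, hδ, fun x y t ht s hs hxy hts => ?_⟩
  have := h (x, t) ⟨mem_univ _, ht⟩ (y, s) ⟨mem_univ _, hs⟩
    (by rw [Prod.dist_eq, max_lt_iff, dist_eq_norm, Real.dist_eq]; exact ⟨hxy, hts⟩)
  rwa [Real.dist_eq] at this

theorem isBUC_of_modulus {d : ℕ} {T : ℝ} {u : Eucl d → ℝ → ℝ}
    (hb : ∃ K : ℝ, ∀ x, ∀ t ∈ Icc 0 T, |u x t| ≤ K)
    (hu : ∀ ε > 0, ∃ δ > 0, ∀ x y : Eucl d, ∀ t ∈ Icc 0 T, ∀ s ∈ Icc 0 T, ‖x - y‖ < δ →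
      |t - s| < δ → |u x t - u y s| < ε) : IsBUC T u := by
  refine ⟨hb, Metric.uniformContinuousOn_iff.2 fun ε hε => ?_⟩
  obtain ⟨δ, hδ, h⟩ := hu ε hε
  refine ⟨δ, hδ, fun z hz w hw hzw => ?_⟩
  rw [Prod.dist_eq, max_lt_iff, dist_eq_norm, Real.dist_eq] at hzw
  rw [Real.dist_eq]
  exact h _ _ _ hz.2 _ hw.2 hzw.1 hzw.2

theorem hasGradientAt_norm_sub_sq {d : ℕ} (x y : Eucl d) :
    HasGradientAt (fun z : Eucl d => ‖z - y‖ ^ 2) ((2 : ℝ) • (x - y)) x := by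
  rw [hasGradientAt_iff_hasFDerivAt]
  have h := ((hasFDerivAt_id x).sub_const y).norm_sq
  refine h.congr_fderiv ?_
  ext w
  simp [InnerProductSpace.toDual_apply_apply]

/-! ### Comparison by doubling of variables. -/

section Comparison

variable {d m : ℕ} {A : Set (Eucl m)} {T M L K : ℝ} {g : Eucl d → A → Eucl d}
  {k : Eucl d → A → ℝ → ℝ}

theorem IsControlProblem.le_hamiltonian (h : IsControlProblem T M L K g k) {x : Eucl d} {t : ℝ}
    (ht : t ∈ Icc 0 T) (ξ : Eucl d) (a : A) :
    -(inner ℝ (g x a) ξ) - k x a t ≤ hamiltonian g k x t ξ := by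
  refine le_ciSup (f := fun a : A => -(inner ℝ (g x a) ξ) - k x a t) ⟨M * ‖ξ‖ + K, ?_⟩ a
  rintro _ ⟨b, rfl⟩
  have h1 := (abs_le.1 (abs_real_inner_le_norm (g x b) ξ)).1
  have h2 := (abs_le.1 (h.cost_le x b t ht)).1
  have h3 := mul_le_mul_of_nonneg_right (h.norm_le x b) (norm_nonneg ξ)
  simp only
  linarith

theorem hamiltonian_le [Nonempty A] {x ξ : Eucl d} {t c : ℝ}
    (h : ∀ a, -(inner ℝ (g x a) ξ) - k x a t ≤ c) : hamiltonian g k x t ξ ≤ c :=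
  ciSup_le h

/-- The cost is uniformly continuous in space globally, but in time only over bounded sets of
positions, by compactness. This forces the order of the constants in the comparison proof. -/
theorem IsControlProblem.exists_cost_modulus [CompactSpace A] (h : IsControlProblem T M L K g k)
    (R : ℝ) {ε : ℝ} (hε : 0 < ε) : ∃ δ > 0, ∀ x : Eucl d, ‖x‖ ≤ R → ∀ a, ∀ t ∈ Icc 0 T,
      ∀ s ∈ Icc 0 T, |t - s| < δ → |k x a t - k x a s| < ε := by
  have hc : IsCompact (((Metric.closedBall (0 : Eucl d) R) ×ˢ (univ : Set A)) ×ˢ Icc 0 T) :=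
    ((isCompact_closedBall _ _).prod isCompact_univ).prod isCompact_Icc
  have hu := hc.uniformContinuousOn_of_continuous
    (h.cost_cont.mono (prod_mono (subset_univ _) Subset.rfl))
  obtain ⟨δ, hδ, hd⟩ := Metric.uniformContinuousOn_iff.1 hu ε hε
  refine ⟨δ, hδ, fun x hx a t ht s hs hts => ?_⟩
  have hx' : x ∈ Metric.closedBall (0 : Eucl d) R := by simpa using hx
  have := hd ((x, a), t) ⟨⟨hx', mem_univ _⟩, ht⟩ ((x, a), s) ⟨⟨hx', mem_univ _⟩, hs⟩
    (by rw [Prod.dist_eq, dist_self, Real.dist_eq]; exact max_lt hδ hts)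
  rwa [Real.dist_eq] at this

theorem norm_lt_of_mul_sq_le {E : Type*} [NormedAddCommGroup E] {x : E} {n c δ : ℝ} (hδ : 0 < δ)
    (hn : n = (c + 1) / δ ^ 2) (hc : 0 ≤ c) (h : n * ‖x‖ ^ 2 ≤ c) : ‖x‖ < δ := by
  by_contra! hx
  have hn0 : 0 ≤ n := by rw [hn]; positivity
  have h1 : n * δ ^ 2 ≤ n * ‖x‖ ^ 2 := by gcongr
  have h2 : n * δ ^ 2 = c + 1 := by rw [hn]; field_simp
  linarith

/-- The penalised difference `Φ` of doubling the variables attains its maximum. -/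
theorem exists_isMaxOn_penalised {u v : Eucl d → ℝ → ℝ} {B : ℝ}
    (hu : UniformContinuousOn (fun z : Eucl d × ℝ => u z.1 z.2) (univ ×ˢ Icc 0 T))
    (hv : UniformContinuousOn (fun z : Eucl d × ℝ => v z.1 z.2) (univ ×ˢ Icc 0 T))
    (hub : ∀ x, ∀ t ∈ Icc 0 T, |u x t| ≤ B) (hvb : ∀ x, ∀ t ∈ Icc 0 T, |v x t| ≤ B)
    {n η β γ : ℝ} (hn : 0 < n) (hη : 0 < η) (hβ : 0 < β) (hγ : 0 < γ)
    {Φ : Eucl d → ℝ → Eucl d → ℝ → ℝ}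
    (hΦ : ∀ x t y s, Φ x t y s = u x t - v y s - n * ‖x - y‖ ^ 2 - η * (t - s) ^ 2
      - β * ‖x‖ ^ 2 - γ * (T - t))
    {x₀ : Eucl d} {t₀ : ℝ} (ht₀ : t₀ ∈ Icc 0 T) (h0 : 0 < Φ x₀ t₀ x₀ t₀) :
    ∃ x, ∃ t ∈ Icc 0 T, ∃ y, ∃ s ∈ Icc 0 T, ∀ x', ∀ t' ∈ Icc 0 T, ∀ y', ∀ s' ∈ Icc 0 T,
      Φ x' t' y' s' ≤ Φ x t y s := by
  have hB : 0 ≤ B := (abs_nonneg _).trans (hub x₀ t₀ ht₀)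
  -- Where `Φ` is positive, each penalty is below `2B`. This confines `x` and `x - y`, so the
  -- maximum can be sought on a compact set.
  have hbound : ∀ c : ℝ, 0 < c → ∀ z : Eucl d, c * ‖z‖ ^ 2 ≤ 2 * B → ‖z‖ ≤ 2 * B / c + 1 := by
    intro c hc z hz
    by_contra! hlt
    have h1 : 0 ≤ 2 * B / c := by positivity
    have h2 : ‖z‖ ≤ ‖z‖ ^ 2 := by nlinarith
    have h3 : 2 * B / c < ‖z‖ ^ 2 := by linarith
    rw [div_lt_iff₀ hc] at h3
    linarith
  set R := (2 * B / β + 1) + (2 * B / n + 1) with hR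
  set S : Set ((Eucl d × ℝ) × (Eucl d × ℝ)) :=
    ((Metric.closedBall 0 R) ×ˢ Icc 0 T) ×ˢ ((Metric.closedBall 0 R) ×ˢ Icc 0 T) with hS
  have hin : ∀ x, ∀ t ∈ Icc 0 T, ∀ y, ∀ s ∈ Icc 0 T, 0 < Φ x t y s →
      ((x, t), (y, s)) ∈ S := by
    intro x t ht y s hs hpos
    rw [hΦ] at hpos
    have h1 := (abs_le.1 (hub x t ht)).2
    have h2 := (abs_le.1 (hvb y s hs)).1
    have h3 : 0 ≤ γ * (T - t) := mul_nonneg hγ.le (sub_nonneg.2 ht.2)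
    have h4 : 0 ≤ η * (t - s) ^ 2 := by positivity
    have h5 : 0 ≤ n * ‖x - y‖ ^ 2 := by positivity
    have h6 : 0 ≤ β * ‖x‖ ^ 2 := by positivity
    have hx := hbound β hβ x (by linarith)
    have hxy := hbound n hn (x - y) (by linarith)
    have hy : ‖y‖ ≤ ‖x‖ + ‖x - y‖ := by
      have := norm_sub_le x (x - y)
      simpa using this
    have : 0 ≤ 2 * B / n := by positivity
    refine ⟨⟨?_, ht⟩, ⟨?_, hs⟩⟩
    · simp only [mem_closedBall_zero_iff]; linarith
    · simp only [mem_closedBall_zero_iff]; linarith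
  have hcomp : IsCompact S := ((isCompact_closedBall _ _).prod isCompact_Icc).prod
    ((isCompact_closedBall _ _).prod isCompact_Icc)
  have hcont : ContinuousOn (fun p : (Eucl d × ℝ) × (Eucl d × ℝ) =>
      Φ p.1.1 p.1.2 p.2.1 p.2.2) S := by
    simp only [hΦ]
    have hu' := hu.continuousOn.comp (continuous_fst (X := Eucl d × ℝ) (Y := Eucl d × ℝ)).continuousOn
      (s := S) fun p hp => ⟨mem_univ _, hp.1.2⟩
    have hv' := hv.continuousOn.comp (continuous_snd (X := Eucl d × ℝ) (Y := Eucl d × ℝ)).continuousOn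
      (s := S) fun p hp => ⟨mem_univ _, hp.2.2⟩
    refine ((((hu'.sub hv').sub ?_).sub ?_).sub ?_).sub ?_
    all_goals exact Continuous.continuousOn (by fun_prop)
  obtain ⟨p, hp, hmax⟩ := hcomp.exists_isMaxOn ⟨_, hin x₀ t₀ ht₀ x₀ t₀ ht₀ h0⟩ hcont
  refine ⟨p.1.1, p.1.2, hp.1.2, p.2.1, p.2.2, hp.2.2, fun x t ht y s hs => ?_⟩
  by_cases hpos : 0 < Φ x t y s
  · exact hmax (hin x t ht y s hs hpos)
  · have := hmax (hin x₀ t₀ ht₀ x₀ t₀ ht₀ h0)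
    simp only [mem_ofPred_eq] at this
    linarith

/-- One formula for both test functions: `n` and `β` stand for the terms constant in time, and `γ =
0` is taken on the supersolution side. -/
theorem hasDerivAt_penalty (n η β γ c : ℝ) (s t : ℝ) :
    HasDerivAt (fun r : ℝ => n + η * (r - s) ^ 2 + β + γ * (c - r))
      (2 * η * (t - s) - γ) t := by
  have h1 := ((((hasDerivAt_id t).sub_const s).pow 2).const_mul η).const_add n
  have h2 := (h1.add_const β).add (((hasDerivAt_id t).const_sub c).const_mul γ)
  refine h2.congr_deriv ?_
  simp
  ring

/-- Comparison: a BUC subsolution lies below a BUC supersolution. -/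
theorem IsViscositySolution.le [Nonempty A] [CompactSpace A] (h : IsControlProblem T M L K g k)
    (hT : 0 < T) {lam : ℝ} (hlam : 0 ≤ lam) {ψ u v : Eucl d → ℝ → ℝ} (hψ : IsBUC T ψ)
    (hu : IsBUC T u) (hv : IsBUC T v) (hsu : IsViscositySolution T lam g k ψ u)
    (hsv : IsViscositySolution T lam g k ψ v) (x₀ : Eucl d) {t₀ : ℝ} (ht₀ : t₀ ∈ Icc 0 T) :
    u x₀ t₀ ≤ v x₀ t₀ := by
  by_contra! hlt
  obtain ⟨Bu, hBu⟩ := hu.1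
  obtain ⟨Bv, hBv⟩ := hv.1
  set B := max Bu Bv with hBdef
  have hub : ∀ x, ∀ t ∈ Icc 0 T, |u x t| ≤ B := fun x t ht => (hBu x t ht).trans (le_max_left _ _)
  have hvb : ∀ x, ∀ t ∈ Icc 0 T, |v x t| ≤ B := fun x t ht => (hBv x t ht).trans (le_max_right _ _)
  have hB : 0 ≤ B := (abs_nonneg _).trans (hub x₀ t₀ ht₀)
  have hM : 0 ≤ M := (norm_nonneg _).trans (h.norm_le x₀ (Classical.arbitrary A))
  obtain ⟨σ, hσ, hσe⟩ : ∃ σ > 0, u x₀ t₀ - v x₀ t₀ = 4 * σ :=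
    ⟨(u x₀ t₀ - v x₀ t₀) / 4, by linarith, by ring⟩
  obtain ⟨γ, hγ, hγT⟩ : ∃ γ > 0, γ * T = σ := ⟨σ / T, by positivity, by field_simp⟩
  have hL := h.lip_pos
  -- The strict term `γ` has to beat the gap of the two Hamiltonians: `2Lρ` from the dynamics, and
  -- `ρ` each from the cost in space, the cost in time and the penalty `β`.
  obtain ⟨ρ, hρ, hρσ, hργ⟩ : ∃ ρ > 0, ρ < σ ∧ (2 * L + 3) * ρ < γ := by
    refine ⟨min (σ / 2) (γ / (2 * L + 4)), by positivity, ?_, ?_⟩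
    · exact (min_le_left _ _).trans_lt (by linarith)
    · calc (2 * L + 3) * min (σ / 2) (γ / (2 * L + 4)) ≤ (2 * L + 3) * (γ / (2 * L + 4)) := by
            gcongr; exact min_le_right _ _
        _ < (2 * L + 4) * (γ / (2 * L + 4)) := by gcongr; linarith
        _ = γ := by field_simp
  obtain ⟨δ₁, hδ₁, hmu⟩ := hu.exists_modulus hρ
  obtain ⟨δ₂, hδ₂, hmv⟩ := hv.exists_modulus hρ
  obtain ⟨δ₃, hδ₃, hmψ⟩ := hψ.exists_modulus hρ
  obtain ⟨δ₄, hδ₄, hmk⟩ := h.cost_unif ρ hρ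
  set δ := min (min δ₁ δ₂) (min δ₃ δ₄) with hδdef
  have hδ : 0 < δ := by positivity
  have hδ1 : δ ≤ δ₁ := (min_le_left _ _).trans (min_le_left _ _)
  have hδ2 : δ ≤ δ₂ := (min_le_left _ _).trans (min_le_right _ _)
  have hδ3 : δ ≤ δ₃ := (min_le_right _ _).trans (min_le_left _ _)
  have hδ4 : δ ≤ δ₄ := (min_le_right _ _).trans (min_le_right _ _)
  obtain ⟨n, hn⟩ : ∃ n, n = (2 * B + 1) / δ ^ 2 := ⟨_, rfl⟩
  have hn0 : 0 < n := by rw [hn]; positivity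
  -- The second bound controls the gradient of the `β` penalty: `β‖x‖² ≤ 2B` gives `(M · 2β‖x‖)² ≤
  -- 8M²Bβ`. The constant `β` precedes `η`, because the time modulus of the cost needs the radius
  -- `R`, which depends on `β`.
  obtain ⟨β, hβ, hβx, hβM⟩ : ∃ β > 0, β * ‖x₀‖ ^ 2 ≤ σ ∧ β * (8 * M ^ 2 * B) ≤ ρ ^ 2 := by
    refine ⟨min (σ / (‖x₀‖ ^ 2 + 1)) (ρ ^ 2 / (8 * M ^ 2 * B + 1)), by positivity, ?_, ?_⟩
    · calc _ ≤ σ / (‖x₀‖ ^ 2 + 1) * ‖x₀‖ ^ 2 := by gcongr; exact min_le_left _ _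
        _ ≤ σ / (‖x₀‖ ^ 2 + 1) * (‖x₀‖ ^ 2 + 1) := by gcongr; linarith
        _ = σ := by field_simp
    · calc _ ≤ ρ ^ 2 / (8 * M ^ 2 * B + 1) * (8 * M ^ 2 * B) := by gcongr; exact min_le_right _ _
        _ ≤ ρ ^ 2 / (8 * M ^ 2 * B + 1) * (8 * M ^ 2 * B + 1) := by gcongr; linarith
        _ = ρ ^ 2 := by field_simp
  obtain ⟨R, hR⟩ : ∃ R, ∀ x : Eucl d, β * ‖x‖ ^ 2 ≤ 2 * B → ‖x‖ ≤ R := by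
    refine ⟨Real.sqrt (2 * B / β), fun x hx => Real.le_sqrt_of_sq_le ?_⟩
    rw [le_div_iff₀ hβ]
    linarith
  obtain ⟨δ₅, hδ₅, hkt⟩ := h.exists_cost_modulus R hρ
  set δ' := min δ δ₅ with hδ'def
  have hδ' : 0 < δ' := by positivity
  obtain ⟨η, hη⟩ : ∃ η, η = (2 * B + 1) / δ' ^ 2 := ⟨_, rfl⟩
  have hη0 : 0 < η := by rw [hη]; positivity
  obtain ⟨Φ, hΦ⟩ : ∃ Φ : Eucl d → ℝ → Eucl d → ℝ → ℝ, ∀ x t y s, Φ x t y s =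
      u x t - v y s - n * ‖x - y‖ ^ 2 - η * (t - s) ^ 2 - β * ‖x‖ ^ 2 - γ * (T - t) :=
    ⟨_, fun _ _ _ _ => rfl⟩
  -- Of the initial gap `4σ`, one `σ` is spent on `γ(T - t₀)` and one on `β‖x₀‖²`.
  have hΦ0 : 2 * σ ≤ Φ x₀ t₀ x₀ t₀ := by
    rw [hΦ]
    have : γ * (T - t₀) ≤ σ := by
      rw [← hγT]
      gcongr
      linarith [ht₀.1]
    simp only [sub_self, norm_zero]
    linarith
  obtain ⟨x, t, ht, y, s, hs, hmax⟩ := exists_isMaxOn_penalised hu.2 hv.2 hub hvb hn0 hη0 hβ hγ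
    hΦ ht₀ (by linarith)
  have hΦm : 2 * σ ≤ Φ x t y s := hΦ0.trans (hmax _ _ ht₀ _ _ ht₀)
  have hΦm' := hΦm
  rw [hΦ] at hΦm'
  have p1 := (abs_le.1 (hub x t ht)).2
  have p2 := (abs_le.1 (hvb y s hs)).1
  have p3 : 0 ≤ γ * (T - t) := mul_nonneg hγ.le (sub_nonneg.2 ht.2)
  have p4 : 0 ≤ η * (t - s) ^ 2 := by positivity
  have p5 : 0 ≤ n * ‖x - y‖ ^ 2 := by positivity
  have p6 : 0 ≤ β * ‖x‖ ^ 2 := by positivity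
  have hxy : ‖x - y‖ < δ := norm_lt_of_mul_sq_le hδ hn (by positivity) (by linarith)
  have hts : |t - s| < δ' := by
    rw [← Real.norm_eq_abs]
    refine norm_lt_of_mul_sq_le hδ' hη (by positivity) ?_
    rw [Real.norm_eq_abs, sq_abs]
    linarith
  have hts1 : |t - s| < δ := hts.trans_le (min_le_left _ _)
  have hxR : ‖x‖ ≤ R := hR x (by linarith)
  -- Comparing the maximum with its value at `(x, t, x, s)` bounds the penalty by an increment of
  -- `v`. It is thus small, not merely bounded, which the Lipschitz error `2L · n‖x - y‖²` requires.
  have hpen : n * ‖x - y‖ ^ 2 ≤ ρ := by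
    have h1 := hmax x t ht x s hs
    rw [hΦ, hΦ] at h1
    have h2 := (abs_lt.1 (hmv x y s hs s hs (hxy.trans_le hδ2) (by simpa using hδ₂))).2
    simp only [sub_self, norm_zero] at h1
    linarith
  have hβx' : M * (2 * β * ‖x‖) ≤ ρ := by
    refine (abs_le_of_sq_le_sq' ?_ hρ.le).2
    calc (M * (2 * β * ‖x‖)) ^ 2 = 4 * M ^ 2 * β * (β * ‖x‖ ^ 2) := by ring
      _ ≤ 4 * M ^ 2 * β * (2 * B) := by exact mul_le_mul_of_nonneg_left (by linarith) (by positivity)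
      _ = β * (8 * M ^ 2 * B) := by ring
      _ ≤ ρ ^ 2 := hβM
  -- At a terminal time `u` and `v` agree, so the gap `u x t - v y s` would be below `ρ < σ`,
  -- against `2σ`.
  have htT : t ≠ T := by
    rintro rfl
    have h1 := (abs_lt.1 (hmv x y t ht s hs (hxy.trans_le hδ2) (hts1.trans_le hδ2))).2
    have h2 : u x t = v x t := (hsu.2.2 x).trans (hsv.2.2 x).symm
    linarith
  have hsT : s ≠ T := by
    rintro rfl
    have h1 := (abs_lt.1 (hmu x y t ht s hs (hxy.trans_le hδ1) (hts1.trans_le hδ1))).2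
    have h2 : u y s = v y s := (hsu.2.2 y).trans (hsv.2.2 y).symm
    linarith
  have ht' : t ∈ Ico 0 T := ⟨ht.1, lt_of_le_of_ne ht.2 htT⟩
  have hs' : s ∈ Ico 0 T := ⟨hs.1, lt_of_le_of_ne hs.2 hsT⟩
  have gx0 := hasGradientAt_norm_sub_sq x (0 : Eucl d)
  have gxy := hasGradientAt_norm_sub_sq x y
  have gyx := hasGradientAt_norm_sub_sq y x
  have hsub := hsu.1 (fun z => n * ‖z.1 - y‖ ^ 2 + η * (z.2 - s) ^ 2 + β * ‖z.1 - 0‖ ^ 2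
      + γ * (T - z.2)) (by
        have e1 : ContDiff ℝ 1 fun z : Eucl d × ℝ => ‖z.1 - y‖ ^ 2 :=
          ContDiff.norm_sq ℝ (by fun_prop)
        have e2 : ContDiff ℝ 1 fun z : Eucl d × ℝ => ‖z.1 - 0‖ ^ 2 :=
          ContDiff.norm_sq ℝ (by fun_prop)
        fun_prop) x t ht' (by
      have : IsMaxOn (fun z : Eucl d × ℝ => u z.1 z.2 - (n * ‖z.1 - y‖ ^ 2 + η * (z.2 - s) ^ 2
          + β * ‖z.1 - 0‖ ^ 2 + γ * (T - z.2))) (univ ×ˢ Ico 0 T) (x, t) := by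
        intro z hz
        have := hmax z.1 z.2 ⟨hz.2.1, hz.2.2.le⟩ y s hs
        rw [hΦ, hΦ] at this
        simp only [mem_ofPred_eq, sub_zero]
        linarith
      exact this.localize)
  have hsup := hsv.2.1 (fun z => -(n * ‖z.1 - x‖ ^ 2 + η * (z.2 - t) ^ 2 + 0 + 0 * (T - z.2))) (by
        have e1 : ContDiff ℝ 1 fun z : Eucl d × ℝ => ‖z.1 - x‖ ^ 2 :=
          ContDiff.norm_sq ℝ (by fun_prop)
        fun_prop) y s hs' (by
      have : IsMinOn (fun z : Eucl d × ℝ => v z.1 z.2 - -(n * ‖z.1 - x‖ ^ 2 + η * (z.2 - t) ^ 2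
          + 0 + 0 * (T - z.2))) (univ ×ˢ Ico 0 T) (y, s) := by
        intro z hz
        have := hmax x t ht z.1 z.2 ⟨hz.2.1, hz.2.2.le⟩
        rw [hΦ, hΦ, norm_sub_rev x y, norm_sub_rev x z.1] at this
        simp only [mem_ofPred_eq]
        linarith
      exact this.localize)
  simp only at hsub hsup
  rw [(hasDerivAt_penalty _ η _ γ T s t).deriv] at hsub
  rw [(hasDerivAt_penalty _ η 0 0 T t s).fun_neg.deriv] at hsup
  have G1 : gradient (fun z : Eucl d => n * ‖z - y‖ ^ 2 + η * (t - s) ^ 2 + β * ‖z - 0‖ ^ 2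
      + γ * (T - t)) x = (2 * n) • (x - y) + (2 * β) • x := by
    apply HasGradientAt.gradient
    rw [hasGradientAt_iff_hasFDerivAt] at *
    have := ((((gxy.const_mul n).add_const (η * (t - s) ^ 2)).add (gx0.const_mul β)).add_const
      (γ * (T - t)))
    refine this.congr_fderiv ?_
    ext w
    simp
    ring
  have G2 : gradient (fun z : Eucl d => -(n * ‖z - x‖ ^ 2 + η * (s - t) ^ 2 + 0 + 0 * (T - s))) y
      = (2 * n) • (x - y) := by
    apply HasGradientAt.gradient
    rw [hasGradientAt_iff_hasFDerivAt] at *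
    have := (((gyx.const_mul n).add_const (η * (s - t) ^ 2)).add_const 0).add_const
      (0 * (T - s)) |>.fun_neg
    refine this.congr_fderiv ?_
    ext w
    simp
    ring
  rw [G1] at hsub
  rw [G2] at hsup
  obtain ⟨hs1, hs2⟩ := max_le_iff.1 hsub
  -- If the obstacle is active for `v`, then `u - v` is at most an increment of `ψ`, too small.
  -- Otherwise the two equations are subtracted: the time penalties cancel and `γ` remains, so `lam
  -- = 0` is allowed.
  rcases le_max_iff.1 hsup with hv1 | hv2
  · have := (abs_lt.1 (hmψ x y t ht s hs (hxy.trans_le hδ3) (hts1.trans_le hδ3))).2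
    linarith
  · have hH : hamiltonian g k y s ((2 * n) • (x - y)) ≤
        hamiltonian g k x t ((2 * n) • (x - y) + (2 * β) • x) + (2 * L + 3) * ρ := by
      refine hamiltonian_le fun a => ?_
      have h1 := h.le_hamiltonian (x := x) ht ((2 * n) • (x - y) + (2 * β) • x) a
      have h2 := (abs_lt.1 (hmk x y (hxy.trans_le hδ4) a s hs)).2
      have h3 := (abs_lt.1 (hkt x hxR a t ht s hs (hts.trans_le (min_le_right _ _)))).2
      have h4 : inner ℝ (g x a) ((2 * β) • x) ≤ ρ := by
        refine (real_inner_le_norm _ _).trans (le_trans ?_ hβx')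
        rw [norm_smul, Real.norm_of_nonneg (by positivity)]
        gcongr
        exact h.norm_le x a
      have h5 : inner ℝ (g x a - g y a) ((2 * n) • (x - y)) ≤ 2 * L * ρ := by
        refine (real_inner_le_norm _ _).trans ?_
        rw [norm_smul, Real.norm_of_nonneg (by positivity)]
        calc _ ≤ L * ‖x - y‖ * (2 * n * ‖x - y‖) := by gcongr; exact h.lip x y a
          _ = 2 * L * (n * ‖x - y‖ ^ 2) := by ring
          _ ≤ _ := by gcongr
      rw [inner_add_right] at h1
      rw [inner_sub_left] at h5
      linarith
    have : 0 ≤ lam * (u x t - v y s) := mul_nonneg hlam (by linarith)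
    linarith

end Comparison

/-! ### The stopping value: bounds, dynamic programming, uniform continuity. -/

section StoppingValue

variable {d m : ℕ} {A : Set (Eucl m)} {T M L K lam B : ℝ} {g : Eucl d → A → Eucl d}
  {k : Eucl d → A → ℝ → ℝ} {ψ : Eucl d → ℝ → ℝ} {α : ℝ → A} {x : Eucl d} {y : ℝ → Eucl d}
  {t t' τ : ℝ}

/-- The discounted running cost between the times `t` and `τ`. -/
noncomputable def runningCost (lam : ℝ) (k : Eucl d → A → ℝ → ℝ) (α : ℝ → A) (y : ℝ → Eucl d)
    (t τ : ℝ) : ℝ :=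
  ∫ s in t..τ, Real.exp (-lam * (s - t)) * k (y s) (α s) s

/-- The total costs that can be realised from `(x, t)` with the stopping cost `ψ`. -/
def payoffs (T lam : ℝ) (g : Eucl d → A → Eucl d) (k : Eucl d → A → ℝ → ℝ)
    (ψ : Eucl d → ℝ → ℝ) (x : Eucl d) (t : ℝ) : Set ℝ :=
  {c | ∃ α : ℝ → A, Measurable α ∧ ∃ y, IsMild T g α x t y ∧ ∃ τ ∈ Icc t T,
    c = runningCost lam k α y t τ + Real.exp (-lam * (τ - t)) * ψ (y τ) τ}

/-- The value of the optimal stopping problem with the stopping cost `ψ`. -/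
noncomputable def stoppingValue (T lam : ℝ) (g : Eucl d → A → Eucl d) (k : Eucl d → A → ℝ → ℝ)
    (ψ : Eucl d → ℝ → ℝ) (x : Eucl d) (t : ℝ) : ℝ :=
  sInf (payoffs T lam g k ψ x t)

theorem IsControlProblem.bound_nonneg [Nonempty A] (h : IsControlProblem T M L K g k) : 0 ≤ M :=
  (norm_nonneg _).trans (h.norm_le 0 (Classical.arbitrary A))

theorem IsControlProblem.cost_bound_nonneg [Nonempty A] (h : IsControlProblem T M L K g k)
    (ht : t ∈ Icc 0 T) : 0 ≤ K :=
  (abs_nonneg _).trans (h.cost_le 0 (Classical.arbitrary A) t ht)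

/-- The time argument `r` covers both the running time and a frozen time. As the cost is continuous
only over `[0, T]`, measurability is obtained after projecting time onto that interval. -/
theorem IsControlProblem.intervalIntegrable_cost (h : IsControlProblem T M L K g k)
    (hα : Measurable α) {a b : ℝ} (ha : a ∈ Icc 0 T) (hb : b ∈ Icc 0 T) {r : ℝ → ℝ}
    (hr : Continuous r) (hrT : ∀ s ∈ Icc 0 T, r s ∈ Icc 0 T)
    (hy : ContinuousOn y (uIcc a b)) :
    IntervalIntegrable (fun s => k (y s) (α s) (r s)) volume a b := by
  have hT : 0 ≤ T := ha.1.trans ha.2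
  have hF : Continuous fun z : (Eucl d × A) × ℝ => k z.1.1 z.1.2 (projIcc 0 T hT z.2) := by
    have : Continuous fun z : (Eucl d × A) × ℝ => (z.1, (projIcc 0 T hT z.2 : ℝ)) :=
      continuous_fst.prodMk (continuous_subtype_val.comp (continuous_projIcc.comp continuous_snd))
    exact h.cost_cont.comp_continuous this fun z => ⟨mem_univ _, (projIcc 0 T hT z.2).2⟩
  have h1 : AEMeasurable y (volume.restrict (uIoc a b)) :=
    (hy.mono uIoc_subset_uIcc).aemeasurable measurableSet_uIoc
  have h2 : AEMeasurable (fun s => k (y s) (α s) (projIcc 0 T hT (r s)))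
      (volume.restrict (uIoc a b)) :=
    hF.measurable.comp_aemeasurable ((h1.prodMk hα.aemeasurable).prodMk hr.measurable.aemeasurable)
  have h3 : IntervalIntegrable (fun s => k (y s) (α s) (projIcc 0 T hT (r s))) volume a b :=
    (intervalIntegrable_const (c := K)).mono_fun' h2.aestronglyMeasurable
      (Eventually.of_forall fun s => h.cost_le _ _ _ (projIcc 0 T hT (r s)).2)
  refine h3.congr_ae ?_
  filter_upwards [ae_restrict_mem measurableSet_uIoc] with s hs
  rw [projIcc_of_mem hT (hrT s (uIcc_subset_Icc ha hb (uIoc_subset_uIcc hs)))]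

theorem IsControlProblem.intervalIntegrable_discounted (h : IsControlProblem T M L K g k)
    (lam : ℝ) (hα : Measurable α) {a b c : ℝ} (ha : a ∈ Icc 0 T) (hb : b ∈ Icc 0 T)
    (hy : ContinuousOn y (uIcc a b)) :
    IntervalIntegrable (fun s => Real.exp (-lam * (s - c)) * k (y s) (α s) s) volume a b :=
  (h.intervalIntegrable_cost hα ha hb continuous_id (fun _ => id) hy).continuousOn_mul
    (by fun_prop)

theorem exp_discount_le_one (hlam : 0 ≤ lam) {r : ℝ} (hr : 0 ≤ r) :
    Real.exp (-lam * r) ≤ 1 := by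
  rw [Real.exp_le_one_iff]
  nlinarith

theorem abs_discount_mul_sub_le (hlam : 0 ≤ lam) {r z : ℝ} (hr : 0 ≤ r) (hz : |z| ≤ B) :
    |Real.exp (-lam * r) * z - z| ≤ lam * r * B := by
  have h1 := exp_discount_le_one hlam hr
  have h2 := Real.add_one_le_exp (-lam * r)
  have h3 : |Real.exp (-lam * r) - 1| ≤ lam * r := by
    rw [abs_of_nonpos (by linarith)]
    linarith
  calc |Real.exp (-lam * r) * z - z| = |Real.exp (-lam * r) - 1| * |z| := by
        rw [← abs_mul]; ring_nf
    _ ≤ lam * r * B := by gcongr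

theorem IsControlProblem.abs_runningCost_le (h : IsControlProblem T M L K g k) (hlam : 0 ≤ lam)
    (ht : 0 ≤ t) (hτ : τ ∈ Icc t T) : |runningCost lam k α y t τ| ≤ K * (τ - t) := by
  rw [← abs_of_nonneg (sub_nonneg.2 hτ.1), ← Real.norm_eq_abs, runningCost]
  refine intervalIntegral.norm_integral_le_of_norm_le_const fun s hs => ?_
  rw [uIoc_of_le hτ.1] at hs
  rw [Real.norm_eq_abs, abs_mul, abs_of_nonneg (Real.exp_nonneg _)]
  have h1 := exp_discount_le_one hlam (sub_nonneg.2 hs.1.le)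
  have h2 := h.cost_le (y s) (α s) s ⟨ht.trans hs.1.le, hs.2.trans hτ.2⟩
  have h3 := mul_le_mul h1 h2 (abs_nonneg _) zero_le_one
  linarith

theorem IsControlProblem.runningCost_add (h : IsControlProblem T M L K g k) (hα : Measurable α)
    (hy : ContinuousOn y (Icc t T)) (ht : 0 ≤ t) (htt' : t ≤ t') (ht'τ : t' ≤ τ) (hτ : τ ≤ T) :
    runningCost lam k α y t τ =
      runningCost lam k α y t t' + Real.exp (-lam * (t' - t)) * runningCost lam k α y t' τ := by
  have hT : 0 ≤ T := by linarith
  have hi : ∀ a b, a ∈ Icc t T → b ∈ Icc t T → IntervalIntegrable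
      (fun s => Real.exp (-lam * (s - t)) * k (y s) (α s) s) volume a b := fun a b ha hb =>
    h.intervalIntegrable_discounted lam hα ⟨ht.trans ha.1, ha.2⟩ ⟨ht.trans hb.1, hb.2⟩
      (hy.mono (uIcc_subset_Icc ha hb))
  unfold runningCost
  rw [← intervalIntegral.integral_add_adjacent_intervals
    (hi t t' ⟨le_rfl, by linarith⟩ ⟨htt', by linarith⟩)
    (hi t' τ ⟨htt', by linarith⟩ ⟨by linarith, hτ⟩), ← intervalIntegral.integral_const_mul]
  congr 2
  ext s
  rw [← mul_assoc, ← Real.exp_add]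
  ring_nf

/-- The bound for the value function. -/
theorem IsControlProblem.abs_payoff_le [Nonempty A] (h : IsControlProblem T M L K g k)
    (hlam : 0 ≤ lam) (hψ : ∀ x, ∀ t ∈ Icc 0 T, |ψ x t| ≤ B) (ht : t ∈ Icc 0 T) {c : ℝ}
    (hc : c ∈ payoffs T lam g k ψ x t) : |c| ≤ K * T + B := by
  obtain ⟨α, hα, y, hy, τ, hτ, rfl⟩ := hc
  have h1 := h.abs_runningCost_le (α := α) (y := y) hlam ht.1 hτ
  have hK := h.cost_bound_nonneg ht
  have h2 := exp_discount_le_one hlam (sub_nonneg.2 hτ.1)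
  have h3 := hψ (y τ) τ ⟨ht.1.trans hτ.1, hτ.2⟩
  have h4 : |Real.exp (-lam * (τ - t)) * ψ (y τ) τ| ≤ 1 * B := by
    rw [abs_mul, abs_of_nonneg (Real.exp_nonneg _)]
    exact mul_le_mul h2 h3 (abs_nonneg _) zero_le_one
  have h5 : K * (τ - t) ≤ K * T := by
    gcongr
    linarith [ht.1, hτ.2]
  have := abs_add_le (runningCost lam k α y t τ) (Real.exp (-lam * (τ - t)) * ψ (y τ) τ)
  linarith

theorem IsControlProblem.exists_isMild (h : IsControlProblem T M L K g k) (hα : Measurable α)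
    (x : Eucl d) (ht : t ≤ T) : ∃ y, IsMild T g α x t y :=
  OptVisit.exists_isMild h.cont h.norm_le h.lip_pos h.lip hα x ht

theorem IsControlProblem.payoffs_nonempty [Nonempty A] (h : IsControlProblem T M L K g k)
    (ht : t ≤ T) : (payoffs T lam g k ψ x t).Nonempty := by
  have hα : Measurable fun _ : ℝ => Classical.arbitrary A := measurable_const
  obtain ⟨y, hy⟩ := h.exists_isMild hα x ht
  exact ⟨_, _, hα, y, hy, t, ⟨le_rfl, ht⟩, rfl⟩

theorem IsControlProblem.bddBelow_payoffs [Nonempty A] (h : IsControlProblem T M L K g k)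
    (hlam : 0 ≤ lam) (hψ : ∀ x, ∀ t ∈ Icc 0 T, |ψ x t| ≤ B) (ht : t ∈ Icc 0 T) :
    BddBelow (payoffs T lam g k ψ x t) :=
  ⟨-(K * T + B), fun _ hc => (abs_le.1 (h.abs_payoff_le hlam hψ ht hc)).1⟩

theorem IsControlProblem.stoppingValue_le [Nonempty A] (h : IsControlProblem T M L K g k)
    (hlam : 0 ≤ lam) (hψ : ∀ x, ∀ t ∈ Icc 0 T, |ψ x t| ≤ B) (ht : t ∈ Icc 0 T)
    (hα : Measurable α) (hy : IsMild T g α x t y) (hτ : τ ∈ Icc t T) :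
    stoppingValue T lam g k ψ x t ≤
      runningCost lam k α y t τ + Real.exp (-lam * (τ - t)) * ψ (y τ) τ :=
  csInf_le (h.bddBelow_payoffs hlam hψ ht) ⟨α, hα, y, hy, τ, hτ, rfl⟩

theorem IsControlProblem.exists_payoff_lt [Nonempty A] (h : IsControlProblem T M L K g k)
    (ht : t ≤ T) {ε : ℝ} (hε : 0 < ε) : ∃ α : ℝ → A, Measurable α ∧ ∃ y, IsMild T g α x t y ∧
      ∃ τ ∈ Icc t T, runningCost lam k α y t τ + Real.exp (-lam * (τ - t)) * ψ (y τ) τ <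
        stoppingValue T lam g k ψ x t + ε := by
  obtain ⟨c, ⟨α, hα, y, hy, τ, hτ, rfl⟩, hc⟩ :=
    Real.lt_sInf_add_pos (h.payoffs_nonempty (lam := lam) (ψ := ψ) (x := x) ht) hε
  exact ⟨α, hα, y, hy, τ, hτ, hc⟩

theorem IsControlProblem.abs_stoppingValue_le [Nonempty A] (h : IsControlProblem T M L K g k)
    (hlam : 0 ≤ lam) (hψ : ∀ x, ∀ t ∈ Icc 0 T, |ψ x t| ≤ B) (x : Eucl d) (ht : t ∈ Icc 0 T) :
    |stoppingValue T lam g k ψ x t| ≤ K * T + B := by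
  have hne := h.payoffs_nonempty (lam := lam) (ψ := ψ) (x := x) ht.2
  rw [abs_le]
  constructor
  · exact le_csInf hne fun c hc => (abs_le.1 (h.abs_payoff_le hlam hψ ht hc)).1
  · obtain ⟨c, hc⟩ := hne
    exact (csInf_le (h.bddBelow_payoffs hlam hψ ht) hc).trans
      (abs_le.1 (h.abs_payoff_le hlam hψ ht hc)).2

theorem IsControlProblem.stoppingValue_le_obstacle [Nonempty A]
    (h : IsControlProblem T M L K g k) (hlam : 0 ≤ lam)
    (hψ : ∀ x, ∀ t ∈ Icc 0 T, |ψ x t| ≤ B) (x : Eucl d) (ht : t ∈ Icc 0 T) :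
    stoppingValue T lam g k ψ x t ≤ ψ x t := by
  have hα : Measurable fun _ : ℝ => Classical.arbitrary A := measurable_const
  obtain ⟨y, hy⟩ := h.exists_isMild hα x ht.2
  have := h.stoppingValue_le hlam hψ ht hα hy ⟨le_rfl, ht.2⟩
  simpa [runningCost, hy.apply_left ht.2] using this

theorem IsControlProblem.stoppingValue_terminal [Nonempty A]
    (h : IsControlProblem T M L K g k) (hT : 0 ≤ T) (hlam : 0 ≤ lam)
    (hψ : ∀ x, ∀ t ∈ Icc 0 T, |ψ x t| ≤ B) (x : Eucl d) :
    stoppingValue T lam g k ψ x T = ψ x T := by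
  refine le_antisymm (h.stoppingValue_le_obstacle hlam hψ x ⟨hT, le_rfl⟩) ?_
  refine le_csInf (h.payoffs_nonempty le_rfl) ?_
  rintro _ ⟨α, hα, y, hy, τ, hτ, rfl⟩
  obtain rfl : τ = T := le_antisymm hτ.2 hτ.1
  simp [runningCost, hy.apply_left le_rfl]

/-- Dynamic programming: one may follow any trajectory up to the time `t'`. -/
theorem IsControlProblem.stoppingValue_le_restart [Nonempty A]
    (h : IsControlProblem T M L K g k) (hlam : 0 ≤ lam)
    (hψ : ∀ x, ∀ t ∈ Icc 0 T, |ψ x t| ≤ B) (ht : t ∈ Icc 0 T) (hα : Measurable α)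
    (hy : IsMild T g α x t y) (ht' : t' ∈ Icc t T) :
    stoppingValue T lam g k ψ x t ≤ runningCost lam k α y t t' +
      Real.exp (-lam * (t' - t)) * stoppingValue T lam g k ψ (y t') t' := by
  refine le_of_forall_pos_le_add fun ε hε => ?_
  obtain ⟨β, hβ, y', hy', τ, hτ, hlt⟩ :=
    h.exists_payoff_lt (lam := lam) (ψ := ψ) (x := y t') ht'.2 hε
  have hγ : Measurable fun s => if s ≤ t' then α s else β s :=
    Measurable.ite measurableSet_Iic hα hβ
  have hz := hy.concat h.cont h.norm_le hα hβ ht' hy'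
  have hle := h.stoppingValue_le hlam hψ ht hγ hz ⟨ht'.1.trans hτ.1, hτ.2⟩
  rw [h.runningCost_add hγ hz.1 ht.1 ht'.1 hτ.1 hτ.2] at hle
  have e1 : runningCost lam k (fun s => if s ≤ t' then α s else β s)
      (fun s => if s ≤ t' then y s else y' s) t t' = runningCost lam k α y t t' := by
    refine intervalIntegral.integral_congr fun s hs => ?_
    rw [uIcc_of_le ht'.1] at hs
    simp [hs.2]
  have e2 : runningCost lam k (fun s => if s ≤ t' then α s else β s)
      (fun s => if s ≤ t' then y s else y' s) t' τ = runningCost lam k β y' t' τ := by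
    refine intervalIntegral.integral_congr_ae (Eventually.of_forall fun s hs => ?_)
    rw [uIoc_of_le hτ.1] at hs
    simp [not_le.2 hs.1]
  -- Stopping at `τ = t'` itself falls into the first branch, where the two paths meet.
  have e3 : (if τ ≤ t' then y τ else y' τ) = y' τ := by
    split_ifs with hc
    · obtain rfl : τ = t' := le_antisymm hc hτ.1
      exact (hy'.apply_left ht'.2).symm
    · rfl
  have e4 : Real.exp (-lam * (τ - t)) =
      Real.exp (-lam * (t' - t)) * Real.exp (-lam * (τ - t')) := by
    rw [← Real.exp_add]; ring_nf
  rw [e1, e2, e3, e4] at hle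
  have h5 := exp_discount_le_one hlam (sub_nonneg.2 ht'.1)
  have h6 := Real.exp_pos (-lam * (t' - t))
  have h7 := mul_le_mul_of_nonneg_left hlt.le h6.le
  have h8 := mul_le_mul_of_nonneg_right h5 hε.le
  linarith

/-- Dynamic programming: the cost of stopping after `t'` is at least that of restarting at `t'`. -/
theorem IsControlProblem.restart_le_payoff [Nonempty A]
    (h : IsControlProblem T M L K g k) (hlam : 0 ≤ lam)
    (hψ : ∀ x, ∀ t ∈ Icc 0 T, |ψ x t| ≤ B) (ht : t ∈ Icc 0 T) (hα : Measurable α)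
    (hy : IsMild T g α x t y) (htt' : t ≤ t') (ht'τ : t' ≤ τ) (hτ : τ ≤ T) :
    runningCost lam k α y t t' +
      Real.exp (-lam * (t' - t)) * stoppingValue T lam g k ψ (y t') t' ≤
    runningCost lam k α y t τ + Real.exp (-lam * (τ - t)) * ψ (y τ) τ := by
  have h1 := h.stoppingValue_le hlam hψ ⟨ht.1.trans htt', ht'τ.trans hτ⟩ hα
    (hy.restart h.cont h.norm_le hα ⟨htt', ht'τ.trans hτ⟩) (τ := τ) ⟨ht'τ, hτ⟩
  have e4 : Real.exp (-lam * (τ - t)) =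
      Real.exp (-lam * (t' - t)) * Real.exp (-lam * (τ - t')) := by
    rw [← Real.exp_add]; ring_nf
  rw [h.runningCost_add hα hy.1 ht.1 htt' ht'τ hτ, e4]
  have := mul_le_mul_of_nonneg_left h1 (Real.exp_nonneg (-lam * (t' - t)))
  linarith

/-- A nearly optimal control and stopping time for `x` is reused from `x'`; the two paths stay
uniformly close. The error is `ε/4` for near-optimality, `ε/4` for the running cost and `ε/2` for
`ψ`. -/
theorem IsControlProblem.exists_space_modulus [Nonempty A]
    (h : IsControlProblem T M L K g k) (hT : 0 < T) (hlam : 0 ≤ lam)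
    (hψ : IsBUC T ψ) {ε : ℝ} (hε : 0 < ε) : ∃ δ > 0, ∀ x x' : Eucl d, ‖x - x'‖ < δ →
      ∀ t ∈ Icc 0 T, stoppingValue T lam g k ψ x' t ≤ stoppingValue T lam g k ψ x t + ε := by
  obtain ⟨B, hB⟩ := hψ.1
  obtain ⟨δ₁, hδ₁, hk⟩ := h.cost_unif (ε / (4 * T)) (by positivity)
  obtain ⟨δ₂, hδ₂, hmψ⟩ := hψ.exists_modulus (half_pos hε)
  have hL := h.lip_pos
  have hE : 0 < 2 * Real.exp (2 * L * T) := by positivity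
  refine ⟨min δ₁ δ₂ / (2 * Real.exp (2 * L * T)), by positivity, fun x x' hxx t ht => ?_⟩
  obtain ⟨α, hα, y, hy, τ, hτ, hlt⟩ :=
    h.exists_payoff_lt (lam := lam) (ψ := ψ) (x := x) ht.2 (ε := ε / 4) (by positivity)
  obtain ⟨y', hy'⟩ := h.exists_isMild hα x' ht.2
  have hle := h.stoppingValue_le hlam hB ht hα hy' hτ
  have hyy : ∀ s ∈ Icc t T, ‖y' s - y s‖ < min δ₁ δ₂ := by
    intro s hs
    rw [norm_sub_rev]
    refine (hy.norm_sub_le_initial h.cont h.norm_le h.lip_pos h.lip hα hy' hs).trans_lt ?_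
    rw [lt_div_iff₀ hE] at hxx
    calc _ ≤ 2 * Real.exp (2 * L * T) * ‖x - x'‖ := by
          gcongr
          linarith [ht.1]
      _ < _ := by linarith
  have hτ0 : τ ∈ Icc 0 T := ⟨ht.1.trans hτ.1, hτ.2⟩
  have h1 : |ψ (y' τ) τ - ψ (y τ) τ| < ε / 2 :=
    hmψ _ _ τ hτ0 τ hτ0 ((hyy τ hτ).trans_le (min_le_right _ _)) (by simpa using hδ₂)
  have h2 : |runningCost lam k α y' t τ - runningCost lam k α y t τ| ≤ ε / 4 := by
    have hsub : uIcc t τ ⊆ Icc t T := uIcc_subset_Icc ⟨le_rfl, ht.2⟩ hτ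
    unfold runningCost
    rw [← intervalIntegral.integral_sub
      (h.intervalIntegrable_discounted lam hα ht hτ0 (hy'.1.mono hsub))
      (h.intervalIntegrable_discounted lam hα ht hτ0 (hy.1.mono hsub)), ← Real.norm_eq_abs]
    have : ε / (4 * T) * |τ - t| ≤ ε / 4 := by
      rw [abs_of_nonneg (sub_nonneg.2 hτ.1)]
      calc _ ≤ ε / (4 * T) * T := by gcongr; linarith [ht.1, hτ.2]
        _ = ε / 4 := by field_simp
    refine (intervalIntegral.norm_integral_le_of_norm_le_const fun s hs => ?_).trans this
    rw [uIoc_of_le hτ.1] at hs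
    rw [← mul_sub, norm_mul, Real.norm_of_nonneg (Real.exp_nonneg _), Real.norm_eq_abs]
    have h3 := (hk (y' s) (y s) ((hyy s ⟨hs.1.le, hs.2.trans hτ.2⟩).trans_le (min_le_left _ _))
      (α s) s ⟨ht.1.trans hs.1.le, hs.2.trans hτ.2⟩).le
    have h4 := exp_discount_le_one hlam (sub_nonneg.2 hs.1.le)
    have h5 := mul_le_mul h4 h3 (abs_nonneg _) zero_le_one
    linarith
  have h6 : Real.exp (-lam * (τ - t)) * (ψ (y' τ) τ - ψ (y τ) τ) ≤ ε / 2 := by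
    have h4 := exp_discount_le_one hlam (sub_nonneg.2 hτ.1)
    calc _ ≤ Real.exp (-lam * (τ - t)) * (ε / 2) := by
          gcongr; exact (abs_lt.1 h1).2.le
      _ ≤ 1 * (ε / 2) := by gcongr
      _ = _ := one_mul _
  have h7 := (abs_le.1 h2).2
  linarith

theorem eventually_mul_lt (c : ℝ) {r : ℝ} (hr : 0 < r) : ∀ᶠ h in 𝓝[>] (0 : ℝ), c * h < r := by
  have : Tendsto (fun h : ℝ => c * h) (𝓝[>] 0) (𝓝 (c * 0)) :=
    ((continuous_const_mul c).tendsto 0).mono_left nhdsWithin_le_nhds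
  rw [mul_zero] at this
  exact this.eventually_lt_const hr

/-- Between `t` and `t'` the path moves by at most `M(t' - t)`, and the running cost and discount
change little, so dynamic programming reduces the matter to the space modulus. -/
theorem IsControlProblem.exists_time_modulus [Nonempty A]
    (h : IsControlProblem T M L K g k) (hT : 0 < T) (hlam : 0 ≤ lam)
    (hψ : IsBUC T ψ) {ε : ℝ} (hε : 0 < ε) : ∃ δ > 0, ∀ x : Eucl d, ∀ t ∈ Icc 0 T,
      ∀ t' ∈ Icc t T, t' - t < δ →
        |stoppingValue T lam g k ψ x t - stoppingValue T lam g k ψ x t'| ≤ ε := by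
  obtain ⟨B, hB⟩ := hψ.1
  have hM := h.bound_nonneg
  have hK := h.cost_bound_nonneg (t := 0) ⟨le_rfl, hT.le⟩
  have hB0 : 0 ≤ B := (abs_nonneg _).trans (hB 0 0 ⟨le_rfl, hT.le⟩)
  obtain ⟨δ₁, hδ₁, hx⟩ := h.exists_space_modulus hT hlam hψ (ε := ε / 4) (by positivity)
  obtain ⟨δ₂, hδ₂, hmψ⟩ := hψ.exists_modulus (ε := ε / 4) (by positivity)
  set B' := K * T + B with hB'
  have hBB' : B ≤ B' := by
    have : 0 ≤ K * T := by positivity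
    linarith
  have hB'0 : 0 ≤ B' := hB0.trans hBB'
  obtain ⟨δ, ⟨⟨⟨hδ4, hδ1⟩, hδ2⟩, hδ3⟩, hδ0⟩ :=
    ((((eventually_mul_lt (K + lam * B') (r := ε / 4) (by positivity)).and
      (eventually_mul_lt M hδ₁)).and (eventually_mul_lt M hδ₂)).and
      (eventually_mul_lt 1 hδ₂)).and self_mem_nhdsWithin |>.exists
  replace hδ0 : 0 < δ := hδ0
  refine ⟨δ, hδ0, fun x t ht t' ht' hd => ?_⟩
  have hd0 : 0 ≤ t' - t := sub_nonneg.2 ht'.1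
  have ht'0 : t' ∈ Icc 0 T := ⟨ht.1.trans ht'.1, ht'.2⟩
  have hmove : ∀ {α : ℝ → A} {y : ℝ → Eucl d}, Measurable α → IsMild T g α x t y →
      ∀ s ∈ Icc t t', ‖y s - x‖ ≤ M * δ := by
    intro α y hα hy s hs
    have := hy.norm_sub_le h.cont h.norm_le hα ⟨le_rfl, ht.2⟩ ⟨hs.1, hs.2.trans ht'.2⟩
    rw [hy.apply_left ht.2, abs_of_nonneg (sub_nonneg.2 hs.1)] at this
    refine this.trans ?_
    gcongr
    linarith [hs.2]
  have hbd := fun z => h.abs_stoppingValue_le hlam hB z ht'0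
  have hsmall : K * (t' - t) + lam * (t' - t) * B' ≤ ε / 4 := by
    have : (K + lam * B') * (t' - t) ≤ (K + lam * B') * δ := by gcongr
    linarith
  rw [abs_le]
  constructor
  · obtain ⟨α, hα, y, hy, τ, hτ, hlt⟩ :=
      h.exists_payoff_lt (lam := lam) (ψ := ψ) (x := x) ht.2 (ε := ε / 4) (by positivity)
    rcases le_or_gt t' τ with hc | hc
    · have h1 := h.restart_le_payoff hlam hB ht hα hy ht'.1 hc hτ.2
      have h2 := (abs_le.1 (h.abs_runningCost_le (α := α) (y := y) hlam ht.1 ht')).1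
      have h3 := (abs_le.1 (abs_discount_mul_sub_le hlam hd0 (hbd (y t')))).1
      have h4 := hx (y t') x ((hmove hα hy t' ⟨ht'.1, le_rfl⟩).trans_lt hδ1) t' ht'0
      linarith
    -- Stopping before `t'` costs about `ψ x t'`, which dominates the value at `(x, t')`.
    · have hτ0 : τ ∈ Icc 0 T := ⟨ht.1.trans hτ.1, hτ.2⟩
      have hτt := sub_nonneg.2 hτ.1
      have h2 := (abs_le.1 (h.abs_runningCost_le (α := α) (y := y) hlam ht.1 hτ)).1
      have h3 := (abs_le.1 (abs_discount_mul_sub_le hlam hτt ((hB (y τ) τ hτ0).trans hBB'))).1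
      have h4 : |ψ (y τ) τ - ψ x t'| < ε / 4 := hmψ _ _ τ hτ0 t' ht'0
        ((hmove hα hy τ ⟨hτ.1, hc.le⟩).trans_lt hδ2) (by
          rw [abs_sub_lt_iff]
          constructor <;> linarith [hτ.1])
      have h5 := h.stoppingValue_le_obstacle hlam hB x ht'0
      have h6 := (abs_lt.1 h4).1
      have h7 : K * (τ - t) + lam * (τ - t) * B' ≤ K * (t' - t) + lam * (t' - t) * B' := by
        gcongr
      linarith
  · have hα : Measurable fun _ : ℝ => Classical.arbitrary A := measurable_const
    obtain ⟨y, hy⟩ := h.exists_isMild hα x ht.2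
    have h1 := h.stoppingValue_le_restart hlam hB ht hα hy ht'
    have h2 := (abs_le.1 (h.abs_runningCost_le (α := fun _ => Classical.arbitrary A) (y := y)
      hlam ht.1 ht')).2
    have h3 := (abs_le.1 (abs_discount_mul_sub_le hlam hd0 (hbd (y t')))).2
    have h4 := hx x (y t') (by
      rw [norm_sub_rev]; exact (hmove hα hy t' ⟨ht'.1, le_rfl⟩).trans_lt hδ1) t' ht'0
    linarith

theorem IsControlProblem.isBUC_stoppingValue [Nonempty A]
    (h : IsControlProblem T M L K g k) (hT : 0 < T) (hlam : 0 ≤ lam) (hψ : IsBUC T ψ) :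
    IsBUC T (stoppingValue T lam g k ψ) := by
  obtain ⟨B, hB⟩ := hψ.1
  refine isBUC_of_modulus ⟨_, fun x t ht => h.abs_stoppingValue_le hlam hB x ht⟩ fun ε hε => ?_
  obtain ⟨δ₁, hδ₁, h1⟩ := h.exists_space_modulus hT hlam hψ (ε := ε / 3) (by positivity)
  obtain ⟨δ₂, hδ₂, h2⟩ := h.exists_time_modulus hT hlam hψ (ε := ε / 3) (by positivity)
  refine ⟨min δ₁ δ₂, by positivity, fun x y t ht s hs hxy hts => ?_⟩
  have hx1 := h1 x y (hxy.trans_le (min_le_left _ _)) t ht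
  have hx2 := h1 y x (by rw [norm_sub_rev]; exact hxy.trans_le (min_le_left _ _)) t ht
  have hd : |stoppingValue T lam g k ψ y t - stoppingValue T lam g k ψ y s| ≤ ε / 3 := by
    have hts' := abs_lt.1 (hts.trans_le (min_le_right _ _))
    rcases le_total t s with hc | hc
    · exact h2 y t ht s ⟨hc, hs.2⟩ (by linarith)
    · rw [abs_sub_comm]
      exact h2 y s hs t ⟨hc, ht.2⟩ (by linarith)
  have := abs_le.1 hd
  rw [abs_lt]
  constructor <;> linarith

end StoppingValue

/-! ### The stopping value solves the obstacle problem. -/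

section ViscosityProperty

variable {d m : ℕ} {A : Set (Eucl m)} {T M L K lam B : ℝ} {g : Eucl d → A → Eucl d}
  {k : Eucl d → A → ℝ → ℝ} {ψ : Eucl d → ℝ → ℝ} {α : ℝ → A} {x : Eucl d} {y : ℝ → Eucl d}
  {t : ℝ}

theorem fderiv_pair_apply {φ : Eucl d × ℝ → ℝ} (hφ : ContDiff ℝ 1 φ) (x : Eucl d) (t : ℝ)
    (w : Eucl d) (r : ℝ) :
    fderiv ℝ φ (x, t) (w, r) =
      inner ℝ w (gradient (fun z => φ (z, t)) x) + r * deriv (fun s => φ (x, s)) t := by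
  have hd : HasFDerivAt φ (fderiv ℝ φ (x, t)) (x, t) :=
    (hφ.differentiable one_ne_zero (x, t)).hasFDerivAt
  have h1 : HasFDerivAt (fun z => φ (z, t))
      ((fderiv ℝ φ (x, t)).comp (ContinuousLinearMap.inl ℝ (Eucl d) ℝ)) x :=
    hd.comp x (hasFDerivAt_prodMk_left x t)
  have h2 : HasFDerivAt (fun s => φ (x, s))
      ((fderiv ℝ φ (x, t)).comp (ContinuousLinearMap.inr ℝ (Eucl d) ℝ)) t :=
    hd.comp t (hasFDerivAt_prodMk_right x t)
  have h3 : inner ℝ w (gradient (fun z => φ (z, t)) x) = fderiv ℝ φ (x, t) (w, 0) := by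
    rw [real_inner_comm, gradient, InnerProductSpace.toDual_symm_apply, h1.fderiv]
    simp
  have h4 : r * deriv (fun s => φ (x, s)) t = fderiv ℝ φ (x, t) (0, r) := by
    rw [h2.hasDerivAt.deriv, ← smul_eq_mul, ← map_smul]
    simp
  rw [h3, h4, ← map_add]
  simp

/-- First-order expansion of a test function along trajectories, uniformly in the controls. -/
theorem IsControlProblem.eventually_expansion_test [Nonempty A]
    (h : IsControlProblem T M L K g k) {φ : Eucl d × ℝ → ℝ} (hφ : ContDiff ℝ 1 φ)
    (x : Eucl d) {t : ℝ} (htT : t < T) {ε : ℝ} (hε : 0 < ε) :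
    ∀ᶠ r in 𝓝[>] (0 : ℝ), ∀ α : ℝ → A, Measurable α → ∀ y, IsMild T g α x t y →
      |φ (y (t + r), t + r) - φ (x, t) - ∫ s in t..(t + r),
        (inner ℝ (g x (α s)) (gradient (fun z => φ (z, t)) x) + deriv (fun s => φ (x, s)) t)|
        ≤ ε * r := by
  have hM := h.bound_nonneg
  have hL := h.lip_pos
  set ξ := gradient (fun z => φ (z, t)) x with hξ
  set q := deriv (fun s => φ (x, s)) t with hq
  have hd : HasFDerivAt φ (fderiv ℝ φ (x, t)) (x, t) :=
    (hφ.differentiable one_ne_zero (x, t)).hasFDerivAt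
  -- The point `(y, time)` moves by at most `(M + 1)r`, so this slope leaves the error `ε/2 · r`.
  -- The other half pays for freezing the field at `x`.
  have hε' : 0 < ε / (2 * (M + 1)) := by positivity
  obtain ⟨δ, hδ, hnear⟩ := Metric.eventually_nhds_iff.1
    (hd.isLittleO.def hε')
  filter_upwards [eventually_mul_lt (M + 1) hδ, eventually_mul_lt (L * M * ‖ξ‖) (half_pos hε),
    eventually_mul_lt 1 (sub_pos.2 htT), self_mem_nhdsWithin] with r h1 h2 h3 h4 α hα y hy
  replace h4 : 0 < r := h4
  have hr : t + r ∈ Icc t T := ⟨by linarith, by linarith⟩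
  have htm : t ∈ Icc t T := ⟨le_rfl, htT.le⟩
  have hmove : ∀ s ∈ Icc t (t + r), ‖y s - x‖ ≤ M * r := by
    intro s hs
    have := hy.norm_sub_le h.cont h.norm_le hα htm ⟨hs.1, hs.2.trans hr.2⟩
    rw [hy.apply_left htT.le, abs_of_nonneg (sub_nonneg.2 hs.1)] at this
    refine this.trans ?_
    gcongr
    linarith [hs.2]
  have hpair : ‖(y (t + r), t + r) - (x, t)‖ ≤ (M + 1) * r := by
    rw [Prod.mk_sub_mk, Prod.norm_mk, add_sub_cancel_left, Real.norm_of_nonneg h4.le, max_le_iff]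
    refine ⟨(hmove _ ⟨hr.1, le_rfl⟩).trans ?_, ?_⟩ <;> nlinarith
  have e1 := hnear (y := (y (t + r), t + r)) (by rw [dist_eq_norm]; linarith)
  rw [Prod.mk_sub_mk, add_sub_cancel_left] at hpair e1
  rw [Real.norm_eq_abs, fderiv_pair_apply hφ, ← hξ, ← hq] at e1
  have e2 : ε / (2 * (M + 1)) * ‖(y (t + r) - x, r)‖ ≤ ε / 2 * r := by
    calc _ ≤ ε / (2 * (M + 1)) * ((M + 1) * r) := by gcongr
      _ = _ := by field_simp
  have hyx : inner ℝ (y (t + r) - x) ξ = ∫ s in t..(t + r), inner ℝ (g (y s) (α s)) ξ := by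
    have hi := hy.intervalIntegrable h.cont h.norm_le hα htm hr
    have h5 := hy.sub_eq h.cont h.norm_le hα htm hr
    rw [hy.apply_left htT.le] at h5
    rw [h5]
    have h6 := (innerSL ℝ ξ).intervalIntegral_comp_comm hi
    simp only [innerSL_apply_apply] at h6
    rw [real_inner_comm, ← h6]
    simp only [real_inner_comm]
  have hi1 : IntervalIntegrable (fun s => inner ℝ (g (y s) (α s)) ξ) volume t (t + r) := by
    have := hy.intervalIntegrable h.cont h.norm_le hα htm hr
    exact ⟨this.1.inner_const ξ, this.2.inner_const ξ⟩
  have hi2 : IntervalIntegrable (fun s => inner ℝ (g x (α s)) ξ) volume t (t + r) := by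
    have := intervalIntegrable_field (a := t) (b := t + r) h.cont h.norm_le hα
      (continuousOn_const (c := x))
    exact ⟨this.1.inner_const ξ, this.2.inner_const ξ⟩
  have e3 : |(∫ s in t..(t + r), inner ℝ (g (y s) (α s)) ξ) -
      ∫ s in t..(t + r), inner ℝ (g x (α s)) ξ| ≤ ε / 2 * r := by
    rw [← intervalIntegral.integral_sub hi1 hi2, ← Real.norm_eq_abs]
    have : ∀ s ∈ uIoc t (t + r), ‖inner ℝ (g (y s) (α s)) ξ - inner ℝ (g x (α s)) ξ‖ ≤ ε / 2 := by
      intro s hs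
      rw [uIoc_of_le hr.1] at hs
      rw [← inner_sub_left]
      refine (norm_inner_le_norm _ _).trans ?_
      calc _ ≤ L * (M * r) * ‖ξ‖ := by
            gcongr
            refine (h.lip _ _ _).trans ?_
            gcongr
            exact hmove s ⟨hs.1.le, hs.2⟩
        _ = L * M * ‖ξ‖ * r := by ring
        _ ≤ _ := h2.le
    have h6 := intervalIntegral.norm_integral_le_of_norm_le_const this
    rwa [add_sub_cancel_left, abs_of_pos h4] at h6
  rw [intervalIntegral.integral_add hi2 intervalIntegrable_const, intervalIntegral.integral_const,
    add_sub_cancel_left, smul_eq_mul]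
  have e4 := abs_le.1 (e1.trans e2)
  have e5 := abs_le.1 e3
  rw [← hyx] at e5
  rw [abs_le]
  constructor <;> linarith

/-- First-order expansion of the running cost along trajectories, uniformly in the controls. -/
theorem IsControlProblem.eventually_expansion_cost [Nonempty A] [CompactSpace A]
    (h : IsControlProblem T M L K g k) (hlam : 0 ≤ lam) (x : Eucl d) {t : ℝ}
    (ht : t ∈ Ico 0 T) {ε : ℝ} (hε : 0 < ε) :
    ∀ᶠ r in 𝓝[>] (0 : ℝ), ∀ α : ℝ → A, Measurable α → ∀ y, IsMild T g α x t y →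
      |runningCost lam k α y t (t + r) - ∫ s in t..(t + r), k x (α s) t| ≤ ε * r := by
  have hM := h.bound_nonneg
  have ht0 : t ∈ Icc 0 T := ⟨ht.1, ht.2.le⟩
  have hK := h.cost_bound_nonneg ht0
  obtain ⟨δ₁, hδ₁, hk1⟩ := h.cost_unif (ε / 3) (by positivity)
  obtain ⟨δ₂, hδ₂, hk2⟩ := h.exists_cost_modulus ‖x‖ (ε := ε / 3) (by positivity)
  filter_upwards [eventually_mul_lt M hδ₁, eventually_mul_lt 1 hδ₂,
    eventually_mul_lt (lam * K) (r := ε / 3) (by positivity),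
    eventually_mul_lt 1 (sub_pos.2 ht.2), self_mem_nhdsWithin] with r h1 h2 h3 h5 h4 α hα y hy
  replace h4 : 0 < r := h4
  have hr : t + r ∈ Icc t T := ⟨by linarith, by linarith⟩
  have hr0 : t + r ∈ Icc 0 T := ⟨ht.1.trans hr.1, hr.2⟩
  have htm : t ∈ Icc t T := ⟨le_rfl, ht.2.le⟩
  unfold runningCost
  rw [← intervalIntegral.integral_sub
    (h.intervalIntegrable_discounted lam hα ht0 hr0 (hy.1.mono (uIcc_subset_Icc htm hr)))
    (h.intervalIntegrable_cost hα ht0 hr0 continuous_const (fun _ _ => ht0)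
      (continuousOn_const (c := x))), ← Real.norm_eq_abs]
  have : ∀ s ∈ uIoc t (t + r),
      ‖Real.exp (-lam * (s - t)) * k (y s) (α s) s - k x (α s) t‖ ≤ ε := by
    intro s hs
    rw [uIoc_of_le hr.1] at hs
    have hs0 : s ∈ Icc 0 T := ⟨ht.1.trans hs.1.le, hs.2.trans hr.2⟩
    have hmove := hy.norm_sub_le h.cont h.norm_le hα htm ⟨hs.1.le, hs.2.trans hr.2⟩
    rw [hy.apply_left ht.2.le, abs_of_nonneg (sub_nonneg.2 hs.1.le)] at hmove
    have hsr : s - t ≤ r := by linarith [hs.2]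
    have f1 := abs_le.1 (abs_discount_mul_sub_le hlam (sub_nonneg.2 hs.1.le)
      (h.cost_le (y s) (α s) s hs0))
    have f2 := abs_lt.1 (hk1 (y s) x (hmove.trans_lt (lt_of_le_of_lt (by gcongr) h1)) (α s) s hs0)
    have f3 := abs_lt.1 (hk2 x le_rfl (α s) s hs0 t ht0 (by
      rw [abs_of_nonneg (sub_nonneg.2 hs.1.le)]; linarith))
    have f4 : lam * (s - t) * K ≤ lam * K * r := by
      calc _ ≤ lam * r * K := by gcongr
        _ = _ := by ring
    rw [Real.norm_eq_abs, abs_le]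
    constructor <;> linarith
  have h6 := intervalIntegral.norm_integral_le_of_norm_le_const this
  rwa [add_sub_cancel_left, abs_of_pos h4] at h6

/-- First-order expansion of the right-hand side of the dynamic programming principle. -/
theorem IsControlProblem.eventually_expansion [Nonempty A] [CompactSpace A]
    (h : IsControlProblem T M L K g k) (hlam : 0 ≤ lam) {φ : Eucl d × ℝ → ℝ}
    (hφ : ContDiff ℝ 1 φ) (x : Eucl d) {t : ℝ} (ht : t ∈ Ico 0 T) (w : ℝ) {ε : ℝ} (hε : 0 < ε) :
    ∀ᶠ r in 𝓝[>] (0 : ℝ), ∀ α : ℝ → A, Measurable α → ∀ y, IsMild T g α x t y →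
      |runningCost lam k α y t (t + r)
        + Real.exp (-lam * r) * (w + (φ (y (t + r), t + r) - φ (x, t))) - w
        - ∫ s in t..(t + r), (k x (α s) t + inner ℝ (g x (α s)) (gradient (fun z => φ (z, t)) x)
          + deriv (fun s => φ (x, s)) t - lam * w)| ≤ ε * r := by
  have hM := h.bound_nonneg
  have ht0 : t ∈ Icc 0 T := ⟨ht.1, ht.2.le⟩
  set ξ := gradient (fun z => φ (z, t)) x with hξ
  set q := deriv (fun s => φ (x, s)) t with hq
  filter_upwards [h.eventually_expansion_test hφ x ht.2 (ε := ε / 4) (by positivity),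
    h.eventually_expansion_cost hlam x ht (ε := ε / 4) (by positivity),
    eventually_mul_lt lam one_pos,
    eventually_mul_lt (lam ^ 2 * |w|) (r := ε / 4) (by positivity),
    eventually_mul_lt (lam * (M * ‖ξ‖ + |q| + ε / 4)) (r := ε / 4) (by positivity),
    eventually_mul_lt 1 (sub_pos.2 ht.2), self_mem_nhdsWithin]
    with r h1 h2 h3 h5 h6 h7 h4 α hα y hy
  replace h4 : 0 < r := h4
  have hr : t + r ∈ Icc t T := ⟨by linarith, by linarith⟩
  have hr0 : t + r ∈ Icc 0 T := ⟨ht.1.trans hr.1, hr.2⟩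
  have e1 := abs_le.1 (h1 α hα y hy)
  have e2 := abs_le.1 (h2 α hα y hy)
  set D := φ (y (t + r), t + r) - φ (x, t) with hD
  set I := ∫ s in t..(t + r), (inner ℝ (g x (α s)) ξ + q) with hI
  set J := ∫ s in t..(t + r), k x (α s) t with hJ
  have hinner : IntervalIntegrable (fun s => inner ℝ (g x (α s)) ξ) volume t (t + r) := by
    have := intervalIntegrable_field (a := t) (b := t + r) h.cont h.norm_le hα
      (continuousOn_const (c := x))
    exact ⟨this.1.inner_const ξ, this.2.inner_const ξ⟩
  have hcost : IntervalIntegrable (fun s => k x (α s) t) volume t (t + r) :=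
    h.intervalIntegrable_cost hα ht0 hr0 continuous_const (fun _ _ => ht0)
      (continuousOn_const (c := x))
  have hsplit : ∫ s in t..(t + r), (k x (α s) t + inner ℝ (g x (α s)) ξ + q - lam * w) =
      J + I - r * (lam * w) := by
    have : ∀ s, k x (α s) t + inner ℝ (g x (α s)) ξ + q - lam * w =
        k x (α s) t + (inner ℝ (g x (α s)) ξ + q) - lam * w := fun s => by ring
    simp only [this]
    rw [intervalIntegral.integral_sub (hcost.add (hinner.add intervalIntegrable_const))
      intervalIntegrable_const, intervalIntegral.integral_add hcost
      (hinner.add intervalIntegrable_const), intervalIntegral.integral_const,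
      add_sub_cancel_left, smul_eq_mul]
  have hIb : |I| ≤ (M * ‖ξ‖ + |q|) * r := by
    have : ∀ s ∈ uIoc t (t + r), ‖inner ℝ (g x (α s)) ξ + q‖ ≤ M * ‖ξ‖ + |q| := by
      intro s _
      refine (norm_add_le _ _).trans (add_le_add ((norm_inner_le_norm _ _).trans ?_) le_rfl)
      gcongr
      exact h.norm_le _ _
    have h6 := intervalIntegral.norm_integral_le_of_norm_le_const this
    rwa [add_sub_cancel_left, abs_of_pos h4, Real.norm_eq_abs] at h6
  have hDb : |D| ≤ (M * ‖ξ‖ + |q| + ε / 4) * r := by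
    have := abs_le.1 hIb
    rw [abs_le]
    constructor <;> linarith
  -- The discount contributes `-lam r w` up to two terms of order `r²`: its effect on the increment
  -- `D`, here, and the second-order remainder of the exponential, in `e5`.
  have e3 := abs_le.1 (abs_discount_mul_sub_le hlam h4.le hDb)
  have e4 : lam * r * ((M * ‖ξ‖ + |q| + ε / 4) * r) ≤ ε / 4 * r := by
    calc _ = lam * (M * ‖ξ‖ + |q| + ε / 4) * r * r := by ring
      _ ≤ _ := by gcongr
  have e5 : |(Real.exp (-lam * r) - 1 - -lam * r) * w| ≤ ε / 4 * r := by
    have h8 : |-lam * r| ≤ 1 := by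
      rw [neg_mul, abs_neg, abs_of_nonneg (by positivity)]
      exact h3.le
    have h9 := Real.abs_exp_sub_one_sub_id_le h8
    rw [abs_mul]
    calc _ ≤ (-lam * r) ^ 2 * |w| := by gcongr
      _ = lam ^ 2 * |w| * r * r := by ring
      _ ≤ _ := by gcongr
  have e6 := abs_le.1 e5
  rw [hsplit, abs_le]
  constructor <;> linarith

/-- The speed bound keeps every trajectory in the touching neighbourhood for a short time that does
not depend on the control. -/
theorem eventually_of_isLocalMinOn {u : Eucl d → ℝ → ℝ} {φ : Eucl d × ℝ → ℝ}
    (h : IsControlProblem T M L K g k) (ht : t ∈ Ico 0 T)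
    (hmin : IsLocalMinOn (fun z : Eucl d × ℝ => u z.1 z.2 - φ z) (univ ×ˢ Ico 0 T) (x, t)) :
    ∀ᶠ r in 𝓝[>] (0 : ℝ), ∀ α : ℝ → A, Measurable α → ∀ y, IsMild T g α x t y →
      u x t + (φ (y (t + r), t + r) - φ (x, t)) ≤ u (y (t + r)) (t + r) := by
  obtain ⟨δ, hδ, hball⟩ := Metric.mem_nhdsWithin_iff.1 hmin
  filter_upwards [eventually_mul_lt M hδ, eventually_mul_lt 1 hδ,
    eventually_mul_lt 1 (sub_pos.2 ht.2), self_mem_nhdsWithin] with r h1 h2 h3 h4 α hα y hy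
  replace h4 : 0 < r := h4
  have hmove := hy.norm_sub_le h.cont h.norm_le hα ⟨le_rfl, ht.2.le⟩
    (b := t + r) ⟨by linarith, by linarith⟩
  rw [hy.apply_left ht.2.le, add_sub_cancel_left, abs_of_pos h4] at hmove
  have := @hball (y (t + r), t + r) ⟨by
    rw [Metric.mem_ball, Prod.dist_eq, max_lt_iff, dist_eq_norm, Real.dist_eq,
      add_sub_cancel_left, abs_of_pos h4]
    exact ⟨hmove.trans_lt h1, by linarith⟩, mem_univ _, by linarith [ht.1], by linarith⟩
  simp only [mem_ofPred_eq] at this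
  linarith

/-- For each `a`, follow the constant control `a` for a short time `r`, use dynamic programming and
divide by `r`. The slack `ε` makes one small `r` sufficient, without a limit. -/
theorem IsControlProblem.stoppingValue_subsolution [Nonempty A] [CompactSpace A]
    (h : IsControlProblem T M L K g k) (hlam : 0 ≤ lam)
    (hψ : ∀ x, ∀ t ∈ Icc 0 T, |ψ x t| ≤ B) {φ : Eucl d × ℝ → ℝ} (hφ : ContDiff ℝ 1 φ)
    (x : Eucl d) {t : ℝ} (ht : t ∈ Ico 0 T)
    (hmax : IsLocalMaxOn (fun z : Eucl d × ℝ => stoppingValue T lam g k ψ z.1 z.2 - φ z)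
      (univ ×ˢ Ico 0 T) (x, t)) :
    obstacleOp lam g k ψ x t (stoppingValue T lam g k ψ x t) (deriv (fun s => φ (x, s)) t)
        (gradient (fun z => φ (z, t)) x) ≤ 0 := by
  have ht0 : t ∈ Icc 0 T := ⟨ht.1, ht.2.le⟩
  refine max_le (sub_nonpos.2 (h.stoppingValue_le_obstacle hlam hψ x ht0)) ?_
  set V := stoppingValue T lam g k ψ with hV
  set ξ := gradient (fun z => φ (z, t)) x with hξ
  set q := deriv (fun s => φ (x, s)) t with hq
  suffices hH : hamiltonian g k x t ξ ≤ q - lam * V x t by linarith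
  refine hamiltonian_le fun a => le_of_forall_pos_le_add fun ε hε => ?_
  have hmin : IsLocalMinOn (fun z : Eucl d × ℝ => -V z.1 z.2 - -φ z) (univ ×ˢ Ico 0 T) (x, t) := by
    refine hmax.neg.congr (Eventually.of_forall fun z => ?_) ⟨mem_univ _, ht⟩
    simp only
    ring
  obtain ⟨r, ⟨⟨⟨h1, h2⟩, h3⟩, h4⟩⟩ := (((h.eventually_expansion hlam hφ x ht (V x t) hε).and
    (eventually_of_isLocalMinOn (u := fun z s => -V z s) (φ := fun z => -φ z) h ht hmin)).and
    (eventually_mul_lt 1 (sub_pos.2 ht.2))).and self_mem_nhdsWithin |>.exists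
  replace h4 : 0 < r := h4
  have hα : Measurable fun _ : ℝ => a := measurable_const
  obtain ⟨y, hy⟩ := h.exists_isMild hα x ht.2.le
  have e1 := (abs_le.1 (h1 _ hα y hy)).2
  have e2 := h2 _ hα y hy
  have e3 := h.stoppingValue_le_restart hlam hψ ht0 hα hy (t' := t + r)
    ⟨by linarith, by linarith⟩
  rw [← hV, add_sub_cancel_left] at e3
  rw [intervalIntegral.integral_const, add_sub_cancel_left, smul_eq_mul] at e1
  have e4 : Real.exp (-lam * r) * V (y (t + r)) (t + r) ≤
      Real.exp (-lam * r) * (V x t + (φ (y (t + r), t + r) - φ (x, t))) := by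
    gcongr
    linarith
  have e5 : 0 ≤ r * (k x a t + inner ℝ (g x a) ξ + q - lam * V x t + ε) := by linarith
  have e6 := nonneg_of_mul_nonneg_right e5 h4
  linarith

/-- Otherwise both terms of the maximum are strictly negative, and no strategy is nearly optimal:
stopping at once overpays by a fixed amount since `V < ψ`, and continuing for time `r` overpays by a
multiple of `r`. -/
theorem IsControlProblem.stoppingValue_supersolution [Nonempty A] [CompactSpace A]
    (h : IsControlProblem T M L K g k) (hlam : 0 ≤ lam) (hψ : IsBUC T ψ)
    {φ : Eucl d × ℝ → ℝ} (hφ : ContDiff ℝ 1 φ) (x : Eucl d) {t : ℝ} (ht : t ∈ Ico 0 T)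
    (hmin : IsLocalMinOn (fun z : Eucl d × ℝ => stoppingValue T lam g k ψ z.1 z.2 - φ z)
      (univ ×ˢ Ico 0 T) (x, t)) :
    0 ≤ obstacleOp lam g k ψ x t (stoppingValue T lam g k ψ x t) (deriv (fun s => φ (x, s)) t)
        (gradient (fun z => φ (z, t)) x) := by
  obtain ⟨B, hB⟩ := hψ.1
  have ht0 : t ∈ Icc 0 T := ⟨ht.1, ht.2.le⟩
  have hK := h.cost_bound_nonneg ht0
  have hM := h.bound_nonneg
  have hB0 : 0 ≤ B := (abs_nonneg _).trans (hB x t ht0)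
  set V := stoppingValue T lam g k ψ with hV
  set ξ := gradient (fun z => φ (z, t)) x with hξ
  set q := deriv (fun s => φ (x, s)) t with hq
  by_contra! hneg
  obtain ⟨hgap, hham⟩ := max_lt_iff.1 hneg
  obtain ⟨η, hη, hηe⟩ : ∃ η > 0, -q + lam * V x t + hamiltonian g k x t ξ = -(3 * η) :=
    ⟨-(-q + lam * V x t + hamiltonian g k x t ξ) / 3, by linarith, by ring⟩
  obtain ⟨σ, hσ, hσe⟩ : ∃ σ > 0, ψ x t - V x t = 3 * σ :=
    ⟨(ψ x t - V x t) / 3, by linarith, by ring⟩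
  obtain ⟨δ, hδ, hmψ⟩ := hψ.exists_modulus hσ
  -- The time `r` is fixed before the strategy, which is `ηr`-optimal and so depends on `r`; hence
  -- the need for uniformity in the controls.
  obtain ⟨r, ⟨⟨⟨⟨⟨⟨⟨h1, h2⟩, h3⟩, h5⟩, h6⟩, h7⟩, h8⟩, h4⟩⟩ :=
    (((((((h.eventually_expansion hlam hφ x ht (V x t) hη).and
    (eventually_of_isLocalMinOn h ht hmin)).and
    (eventually_mul_lt 1 (sub_pos.2 ht.2))).and (eventually_mul_lt (K + lam * B) hσ)).and
    (eventually_mul_lt η hσ)).and (eventually_mul_lt M hδ)).and (eventually_mul_lt 1 hδ)).and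
    self_mem_nhdsWithin |>.exists
  replace h4 : 0 < r := h4
  obtain ⟨α, hα, y, hy, τ, hτ, hlt⟩ :=
    h.exists_payoff_lt (lam := lam) (ψ := ψ) (x := x) ht0.2 (mul_pos hη h4)
  rw [← hV] at hlt
  have hr : t + r ∈ Icc t T := ⟨by linarith, by linarith⟩
  have hr0 : t + r ∈ Icc 0 T := ⟨ht.1.trans hr.1, hr.2⟩
  -- Continuing past `t + r` costs at least `V + 3ηr - ηr`. Stopping earlier costs at least `V + 3σ
  -- - 2σ`, and `ηr < σ`.
  rcases le_or_gt (t + r) τ with hc | hc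
  · have e1 := (abs_le.1 (h1 α hα y hy)).1
    have e2 := h2 α hα y hy
    have e3 := h.restart_le_payoff hlam hB ht0 hα hy hr.1 hc hτ.2
    rw [← hV, add_sub_cancel_left] at e3
    have e4 : Real.exp (-lam * r) * (V x t + (φ (y (t + r), t + r) - φ (x, t))) ≤
        Real.exp (-lam * r) * V (y (t + r)) (t + r) := by gcongr
    have e5 : r * (3 * η) ≤ ∫ s in t..(t + r), (k x (α s) t + inner ℝ (g x (α s)) ξ + q
        - lam * V x t) := by
      have hinner : IntervalIntegrable (fun s => inner ℝ (g x (α s)) ξ) volume t (t + r) := by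
        have := intervalIntegrable_field (a := t) (b := t + r) h.cont h.norm_le hα
          (continuousOn_const (c := x))
        exact ⟨this.1.inner_const ξ, this.2.inner_const ξ⟩
      have hcost : IntervalIntegrable (fun s => k x (α s) t) volume t (t + r) :=
        h.intervalIntegrable_cost hα ht0 hr0 continuous_const (fun _ _ => ht0)
          (continuousOn_const (c := x))
      have := intervalIntegral.integral_mono_on (μ := volume) hr.1
        (intervalIntegrable_const (c := 3 * η))
        (((hcost.add hinner).add (intervalIntegrable_const (c := q))).sub
          (intervalIntegrable_const (c := lam * V x t))) (fun s _ => by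
            have := h.le_hamiltonian (x := x) ht0 ξ (α s)
            linarith)
      rwa [intervalIntegral.integral_const, add_sub_cancel_left, smul_eq_mul] at this
    have := mul_pos hη h4
    linarith
  · have hτ0 : τ ∈ Icc 0 T := ⟨ht.1.trans hτ.1, hτ.2⟩
    have hτt := sub_nonneg.2 hτ.1
    have hτr : τ - t ≤ r := by linarith
    have f1 := (abs_le.1 (h.abs_runningCost_le (α := α) (y := y) hlam ht.1 hτ)).1
    have f2 := (abs_le.1 (abs_discount_mul_sub_le hlam hτt (hB (y τ) τ hτ0))).1
    have hmove := hy.norm_sub_le h.cont h.norm_le hα ⟨le_rfl, ht0.2⟩ hτ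
    rw [hy.apply_left ht0.2, abs_of_nonneg hτt] at hmove
    have f3 : |ψ (y τ) τ - ψ x t| < σ := hmψ _ _ τ hτ0 t ht0
      (hmove.trans_lt (lt_of_le_of_lt (by gcongr) h7)) (by rw [abs_of_nonneg hτt]; linarith)
    have f4 := (abs_lt.1 f3).1
    have f5 : K * (τ - t) + lam * (τ - t) * B ≤ (K + lam * B) * r := by
      calc _ = (K + lam * B) * (τ - t) := by ring
        _ ≤ _ := by gcongr
    linarith

theorem IsControlProblem.isViscositySolution_stoppingValue [Nonempty A] [CompactSpace A]
    (h : IsControlProblem T M L K g k) (hT : 0 < T) (hlam : 0 ≤ lam) (hψ : IsBUC T ψ) :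
    IsViscositySolution T lam g k ψ (stoppingValue T lam g k ψ) := by
  obtain ⟨B, hB⟩ := hψ.1
  exact ⟨fun φ hφ x t ht hmax => h.stoppingValue_subsolution hlam hB hφ x ht hmax,
    fun φ hφ x t ht hmin => h.stoppingValue_supersolution hlam hψ hφ x ht hmin,
    fun x => h.stoppingValue_terminal hT.le hlam hB x⟩

end ViscosityProperty

/-! ### From one stopping problem to the system. -/

section System

variable {d m N : ℕ} {A : Set (Eucl m)} {T lam : ℝ}

theorem nonempty_nextStates {p : Switch N} (hp : p ≠ finalState N) : Nonempty (nextStates p) := by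
  obtain ⟨l, hl⟩ := Function.ne_iff.1 hp
  exact ⟨finalState N, fun _ _ => rfl, l, by simpa [finalState] using hl, rfl⟩

theorem obstacle_le (C : Eucl d → Switch N → Switch N → ℝ) (U : Switch N → Eucl d → ℝ → ℝ)
    {p : Switch N} (q : nextStates p) (x : Eucl d) (t : ℝ) :
    obstacle C U p x t ≤ C x p q + U q x t :=
  ciInf_le (f := fun q : nextStates p => C x p q + U q x t) (finite_range _).bddBelow q

theorem exists_obstacle_eq (C : Eucl d → Switch N → Switch N → ℝ)
    (U : Switch N → Eucl d → ℝ → ℝ) {p : Switch N} (hp : p ≠ finalState N) (x : Eucl d) (t : ℝ) :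
    ∃ q : nextStates p, obstacle C U p x t = C x p q + U q x t := by
  have := nonempty_nextStates hp
  obtain ⟨q, hq⟩ := exists_eq_ciInf_of_finite (f := fun q : nextStates p => C x p q + U q x t)
  exact ⟨q, hq.symm⟩

/-- The switching cost may be unbounded for some destinations: the upper bound uses a cheap
destination, the lower bound only `0 ≤ C`. Finiteness of the destinations gives a common modulus. -/
theorem isBUC_obstacle {C : Eucl d → Switch N → Switch N → ℝ} {U : Switch N → Eucl d → ℝ → ℝ}
    (hC_nonneg : ∀ x p p', 0 ≤ C x p p')
    (hC_unif : ∀ ε > 0, ∃ δ > 0, ∀ x y : Eucl d, ‖x - y‖ < δ →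
      ∀ p, ∀ p' ∈ nextStates p, |C x p p' - C y p p'| < ε)
    (hC_bdd : ∃ K : ℝ, ∀ x p, p ≠ finalState N → ∃ p' ∈ nextStates p, C x p p' ≤ K)
    {p : Switch N} (hp : p ≠ finalState N) (hU : ∀ q ∈ nextStates p, IsBUC T (U q)) :
    IsBUC T (obstacle C U p) := by
  obtain ⟨K, hK⟩ := hC_bdd
  choose B hB using fun q : nextStates p => (hU q q.2).1
  obtain ⟨B', hB'⟩ := (finite_range B).bddAbove
  have hUB : ∀ (q : nextStates p) x, ∀ t ∈ Icc 0 T, |U q x t| ≤ B' := fun q x t ht =>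
    (hB q x t ht).trans (hB' ⟨q, rfl⟩)
  refine isBUC_of_modulus ⟨K + B', fun x t ht => ?_⟩ fun ε hε => ?_
  · obtain ⟨q, hq, hqK⟩ := hK x p hp
    have h1 := obstacle_le C U ⟨q, hq⟩ x t
    have h2 := (abs_le.1 (hUB ⟨q, hq⟩ x t ht)).2
    have h3 := hC_nonneg x p q
    obtain ⟨q', hq'⟩ := exists_obstacle_eq C U hp x t
    have h4 := (abs_le.1 (hUB q' x t ht)).1
    have h5 := hC_nonneg x p q'
    simp only at h1 h2
    rw [abs_le]
    constructor <;> linarith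
  · obtain ⟨δ₀, hδ₀, hC⟩ := hC_unif (ε / 2) (half_pos hε)
    choose δ hδ hmod using fun q : nextStates p => (hU q q.2).exists_modulus (half_pos hε)
    have := nonempty_nextStates hp
    obtain ⟨q₁, hq₁⟩ := Finite.exists_min δ
    have key : ∀ x y : Eucl d, ∀ t ∈ Icc 0 T, ∀ s ∈ Icc 0 T, ‖x - y‖ < min δ₀ (δ q₁) →
        |t - s| < min δ₀ (δ q₁) → obstacle C U p x t < obstacle C U p y s + ε := by
      intro x y t ht s hs hxy hts
      obtain ⟨q, hq⟩ := exists_obstacle_eq C U hp y s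
      have hle : min δ₀ (δ q₁) ≤ δ q := (min_le_right _ _).trans (hq₁ q)
      have h1 := (abs_lt.1 (hC x y (hxy.trans_le (min_le_left _ _)) p q q.2)).2
      have h2 := (abs_lt.1 (hmod q x y t ht s hs (hxy.trans_le hle) (hts.trans_le hle))).2
      have h3 := obstacle_le C U q x t
      linarith
    refine ⟨min δ₀ (δ q₁), lt_min hδ₀ (hδ q₁), fun x y t ht s hs hxy hts => ?_⟩
    have h1 := key x y t ht s hs hxy hts
    have h2 := key y x s hs t ht (by rwa [norm_sub_rev]) (by rwa [abs_sub_comm])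
    rw [abs_lt]
    constructor <;> linarith

theorem IsBUC.congr {u v : Eucl d → ℝ → ℝ} (hu : IsBUC T u)
    (huv : ∀ x, ∀ t ∈ Icc 0 T, u x t = v x t) : IsBUC T v := by
  refine ⟨?_, hu.2.congr fun z hz => huv _ _ hz.2⟩
  obtain ⟨K, hK⟩ := hu.1
  exact ⟨K, fun x t ht => huv x t ht ▸ hK x t ht⟩

/-- Needed because `value` and `stoppingValue` are identified only for times in `[0, T]`; the notion
of solution sees nothing else. -/
theorem IsViscositySolution.congr {g : Eucl d → A → Eucl d} {k : Eucl d → A → ℝ → ℝ}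
    {ψ ψ' u u' : Eucl d → ℝ → ℝ} (hT : 0 ≤ T) (h : IsViscositySolution T lam g k ψ u)
    (hψ : ∀ x, ∀ t ∈ Icc 0 T, ψ x t = ψ' x t) (hu : ∀ x, ∀ t ∈ Icc 0 T, u x t = u' x t) :
    IsViscositySolution T lam g k ψ' u' := by
  have hev : ∀ (φ : Eucl d × ℝ → ℝ) (x : Eucl d) (t : ℝ),
      (fun z : Eucl d × ℝ => u' z.1 z.2 - φ z) =ᶠ[𝓝[univ ×ˢ Ico 0 T] (x, t)]
        fun z => u z.1 z.2 - φ z := fun φ x t => by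
    filter_upwards [self_mem_nhdsWithin] with z hz
    rw [hu _ _ ⟨hz.2.1, hz.2.2.le⟩]
  refine ⟨fun φ hφ x t ht hm => ?_, fun φ hφ x t ht hm => ?_, fun x => ?_⟩
  · have := h.1 φ hφ x t ht (hm.congr (hev φ x t) ⟨mem_univ _, ht⟩)
    unfold obstacleOp at this ⊢
    rwa [hψ x t ⟨ht.1, ht.2.le⟩, hu x t ⟨ht.1, ht.2.le⟩] at this
  · have := h.2.1 φ hφ x t ht (hm.congr (hev φ x t) ⟨mem_univ _, ht⟩)
    unfold obstacleOp at this ⊢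
    rwa [hψ x t ⟨ht.1, ht.2.le⟩, hu x t ⟨ht.1, ht.2.le⟩] at this
  · rw [← hu x T ⟨hT, le_rfl⟩, ← hψ x T ⟨hT, le_rfl⟩]
    exact h.2.2 x

theorem value_finalState (f : Eucl d → A → Switch N → Eucl d)
    (ℓ : Eucl d → A → Switch N → ℝ → ℝ) (C : Eucl d → Switch N → Switch N → ℝ) (x : Eucl d)
    (t : ℝ) : value T lam f ℓ C (finalState N) x t = 0 := by
  rw [value, if_pos rfl]

/-- Each value function is the value of the stopping problem for the obstacle of the others. -/
theorem value_eq_stoppingValue [Nonempty A] {M L K B : ℝ} {f : Eucl d → A → Switch N → Eucl d}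
    {ℓ : Eucl d → A → Switch N → ℝ → ℝ} {C : Eucl d → Switch N → Switch N → ℝ} {p : Switch N}
    (hp : p ≠ finalState N)
    (h : IsControlProblem T M L K (fun x a => f x a p) (fun x a t => ℓ x a p t))
    (hlam : 0 ≤ lam)
    (hB : ∀ x, ∀ t ∈ Icc 0 T, |obstacle C (value T lam f ℓ C) p x t| ≤ B)
    (x : Eucl d) {t : ℝ} (ht : t ∈ Icc 0 T) :
    value T lam f ℓ C p x t = stoppingValue T lam (fun x a => f x a p)
      (fun x a t => ℓ x a p t) (obstacle C (value T lam f ℓ C) p) x t := by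
  rw [value, if_neg hp]
  set S := {c : ℝ | ∃ α : ℝ → A, Measurable α ∧
    ∃ y : ℝ → Eucl d, IsTrajectory T (fun z a => f z a p) α x t y ∧
    ∃ τ ∈ Icc t T, ∃ p' : nextStates p,
      c = (∫ s in t..τ, Real.exp (-lam * (s - t)) * ℓ (y s) (α s) p s)
        + Real.exp (-lam * (τ - t)) * (C (y τ) p p' + value T lam f ℓ C p' (y τ) τ)} with hS
  -- The obstacle is an attained minimum, so a payoff with stopping cost `obstacle` is the payoff of
  -- an actual destination.
  have hsub : payoffs T lam (fun x a => f x a p) (fun x a t => ℓ x a p t)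
      (obstacle C (value T lam f ℓ C) p) x t ⊆ S := by
    rintro _ ⟨α, hα, y, hy, τ, hτ, rfl⟩
    obtain ⟨q, hq⟩ := exists_obstacle_eq C (value T lam f ℓ C) hp (y τ) τ
    exact ⟨α, hα, y, (isTrajectory_iff_isMild h.cont h.norm_le hα ht.2).2 hy, τ, hτ, q, by
      rw [hq]; rfl⟩
  have hlow : ∀ c ∈ S, stoppingValue T lam (fun x a => f x a p)
      (fun x a t => ℓ x a p t) (obstacle C (value T lam f ℓ C) p) x t ≤ c := by
    rintro _ ⟨α, hα, y, hy, τ, hτ, q, rfl⟩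
    refine (h.stoppingValue_le hlam hB ht hα
      ((isTrajectory_iff_isMild h.cont h.norm_le hα ht.2).1 hy) hτ).trans ?_
    have := mul_le_mul_of_nonneg_left (obstacle_le C (value T lam f ℓ C) q (y τ) τ)
      (Real.exp_nonneg (-lam * (τ - t)))
    unfold runningCost
    linarith
  have hne := h.payoffs_nonempty (lam := lam) (ψ := obstacle C (value T lam f ℓ C) p)
    (x := x) ht.2
  exact le_antisymm (csInf_le_csInf ⟨_, hlow⟩ hne hsub) (le_csInf (hne.mono hsub) hlow)

theorem obstacle_congr {C : Eucl d → Switch N → Switch N → ℝ} {U V : Switch N → Eucl d → ℝ → ℝ}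
    {p : Switch N} {x : Eucl d} {t : ℝ} (h : ∀ q ∈ nextStates p, U q x t = V q x t) :
    obstacle C U p x t = obstacle C V p x t := by
  unfold obstacle
  congr 1
  ext q
  rw [h q q.2]

end System

end OptVisit

theorem mainTheorem5 {d m N : ℕ} (A : Set (Eucl m)) (hA : IsCompact A) (hA0 : A.Nonempty)
    (T : ℝ) (hT : 0 < T) (lam : ℝ) (hlam : 0 ≤ lam)
    (f : Eucl d → A → Switch N → Eucl d)
    (hf_cont : ∀ p, Continuous fun z : Eucl d × A => f z.1 z.2 p)
    (hf_bdd : ∃ M : ℝ, ∀ x a p, ‖f x a p‖ ≤ M)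
    (hf_lip : ∃ L : ℝ, ∀ x y a p, ‖f x a p - f y a p‖ ≤ L * ‖x - y‖)
    (ℓ : Eucl d → A → Switch N → ℝ → ℝ)
    (hℓ_nonneg : ∀ x a p, ∀ t ∈ Icc 0 T, 0 ≤ ℓ x a p t)
    (hℓ_bdd : ∃ K : ℝ, ∀ x a p, ∀ t ∈ Icc 0 T, ℓ x a p t ≤ K)
    (hℓ_cont : ∀ p, ContinuousOn (fun z : (Eucl d × A) × ℝ => ℓ z.1.1 z.1.2 p z.2)
      (univ ×ˢ Icc 0 T))
    (hℓ_unif : ∀ ε > 0, ∃ δ > 0, ∀ x y : Eucl d, ‖x - y‖ < δ → ∀ a p, ∀ t ∈ Icc 0 T,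
      |ℓ x a p t - ℓ y a p t| < ε)
    (C : Eucl d → Switch N → Switch N → ℝ)
    (hC_nonneg : ∀ x p p', 0 ≤ C x p p')
    (hC_unif : ∀ ε > 0, ∃ δ > 0, ∀ x y : Eucl d, ‖x - y‖ < δ →
      ∀ p, ∀ p' ∈ nextStates p, |C x p p' - C y p p'| < ε)
    (hC_bdd : ∃ K : ℝ, ∀ x p, p ≠ finalState N → ∃ p' ∈ nextStates p, C x p p' ≤ K) :
    SolvesSystem T lam f ℓ C (value T lam f ℓ C) ∧
    MembersUnique T lam f ℓ C (value T lam f ℓ C) ∧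
    ∀ U : Switch N → Eucl d → ℝ → ℝ, SolvesSystem T lam f ℓ C U →
      ∀ p x, ∀ t ∈ Icc 0 T, U p x t = value T lam f ℓ C p x t := by
  have := hA0.to_subtype
  have := isCompact_iff_compactSpace.1 hA
  obtain ⟨M, hM⟩ := hf_bdd
  obtain ⟨L, hL⟩ := hf_lip
  obtain ⟨K, hK⟩ := hℓ_bdd
  -- The given `L` may be nonpositive, while the weighted norms and the comparison proof use a
  -- positive constant.
  have hprob : ∀ p, IsControlProblem T M (max L 1) K (fun x a => f x a p)
      (fun x a t => ℓ x a p t) := fun p =>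
    { cont := hf_cont p
      norm_le := fun x a => hM x a p
      lip_pos := lt_max_of_lt_right one_pos
      lip := fun x y a => (hL x y a p).trans (by gcongr; exact le_max_left _ _)
      cost_cont := hℓ_cont p
      cost_le := fun x a t ht => by
        rw [abs_of_nonneg (hℓ_nonneg x a p t ht)]
        exact hK x a p t ht
      cost_unif := fun ε hε => by
        obtain ⟨δ, hδ, hd⟩ := hℓ_unif ε hε
        exact ⟨δ, hδ, fun x y hxy a t ht => hd x y hxy a p t ht⟩ }
  set V := value T lam f ℓ C with hV
  have hobs : ∀ p, p ≠ finalState N → (∀ q ∈ nextStates p, IsBUC T (V q)) →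
      IsBUC T (obstacle C V p) := fun p hp hq =>
    isBUC_obstacle hC_nonneg hC_unif hC_bdd hp hq
  have hval : ∀ p, p ≠ finalState N → IsBUC T (obstacle C V p) → ∀ x, ∀ t ∈ Icc 0 T,
      stoppingValue T lam (fun x a => f x a p) (fun x a t => ℓ x a p t) (obstacle C V p) x t =
        V p x t := by
    intro p hp hB x t ht
    obtain ⟨B, hB⟩ := hB.1
    exact (value_eq_stoppingValue hp (hprob p) hlam hB x ht).symm
  -- Regularity comes first, by induction on the zeros: the obstacle at `p` must be BUC before the
  -- one-state theory applies.
  have hBUC : ∀ n, ∀ p : Switch N, zeros p = n → IsBUC T (V p) := by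
    intro n
    induction n using Nat.strong_induction_on with
    | _ n ih =>
      rintro p rfl
      by_cases hp : p = finalState N
      · subst hp
        have hz : V (finalState N) = fun _ _ => 0 := by
          funext x t
          exact value_finalState f ℓ C x t
        rw [hz]
        exact ⟨⟨0, by simp⟩, uniformContinuous_const.uniformContinuousOn⟩
      · have hψ := hobs p hp fun q hq => ih _ (zeros_lt hq) q rfl
        exact ((hprob p).isBUC_stoppingValue hT hlam hψ).congr (hval p hp hψ)
  have hψ : ∀ p, p ≠ finalState N → IsBUC T (obstacle C V p) := fun p hp =>
    hobs p hp fun q _ => hBUC _ q rfl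
  have hsol : ∀ p, p ≠ finalState N → IsViscositySolution T lam (fun x a => f x a p)
      (fun x a t => ℓ x a p t) (obstacle C V p) (V p) := fun p hp =>
    ((hprob p).isViscositySolution_stoppingValue hT hlam (hψ p hp)).congr hT.le
      (fun _ _ _ => rfl) (hval p hp (hψ p hp))
  have huniq : MembersUnique T lam f ℓ C V := fun p hp w hw hsw x t ht =>
    le_antisymm
      (hsw.le (hprob p) hT hlam (hψ p hp) hw (hBUC _ p rfl) (hsol p hp) x ht)
      ((hsol p hp).le (hprob p) hT hlam (hψ p hp) (hBUC _ p rfl) hw hsw x ht)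
  refine ⟨⟨fun p => hBUC _ p rfl, fun x t _ => value_finalState f ℓ C x t, hsol⟩, huniq, ?_⟩
  rintro U ⟨hU, hU0, hUs⟩
  suffices h : ∀ n, ∀ p : Switch N, zeros p = n → ∀ x, ∀ t ∈ Icc 0 T, U p x t = V p x t from
    fun p => h _ p rfl
  intro n
  induction n using Nat.strong_induction_on with
  | _ n ih =>
    rintro p rfl
    by_cases hp : p = finalState N
    · subst hp
      intro x t ht
      rw [hU0 x t ht]
      exact (value_finalState f ℓ C x t).symm
    -- By induction the obstacles built from `U` and from `V` agree at `p`, so `U p` solves the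
    -- problem whose only BUC solution is `V p`.
    · refine huniq p hp (U p) (hU p) ((hUs p hp).congr hT.le (fun x t ht => ?_)
        fun _ _ _ => rfl)
      exact obstacle_congr fun q hq => ih _ (zeros_lt hq) q rfl x t ht
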